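/- **Setting.** Let $d\ge 1$. For a vector $y=(y_1,\dots,y_d)$ put $|y|=y_1+\cdots+y_d$, $|\mathbf y_j|=y_1+\cdots+y_j$ and $|\mathbf y^j|=y_j+\cdots+y_d$ (empty sums are $0$). For any number $e\ge 0$ of variables (for $e=0$ all products and vectors are empty), $\rho\in\mathbb R^e$ with $0<\rho_i<1$, $|\rho|<1$, an integer $N\ge0$ and $\nu\in\mathbb N_0^e$ with $|\nu|\le N$, define the weight $$\mathsf K_{\rho,N}(x)=N!\prod_{i=1}^{e}\frac{\rho_i^{x_i}}{x_i!}\,\frac{(1-|\rho|)^{N-|x|}}{(N-|x|)!},\qquad x\in\mathbb N_0^e,\ |x|\le N,$$ and the multivariable Krawtchouk polynomials $$\mathsf K_\nu(x;\rho,N)=\frac1{(-N)_{|\nu|}}\prod_{j=1}^e(-N+|\mathbf x_{j-1}|+|\boldsymbol\nu^{j+1}|)_{\nu_j}\;{}_2F_1\!\left(\begin{matrix}-\nu_j,\,-x_j\\-N+|\mathbf x_{j-1}|+|\boldsymbol\nu^{j+1}|\end{matrix};\frac{1-|\boldsymbol\rho_{j-1}|}{\rho_j}\right),$$ where $(c)_m\,{}_2F_1(-m,-y;c;z)$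 denotes the polynomial $\sum_{k=0}^m\frac{(-m)_k(-y)_k(c+k)_{m-k}}{k!}z^k$. Let $\mathsf C_\nu(\rho,N)=\sum_{|x|\le N}\mathsf K_\nu(x;\rho,N)^2\,\mathsf K_{\rho,N}(x)$ and $\widehat{\mathsf K}_\nu=\mathsf C_\nu^{-1/2}\mathsf K_\nu$. Let $\tau=(1\,2\cdots d)$ be the cyclic permutation, acting by $\tau y=(y_2,\dots,y_d,y_1)$ on points $y=x$ and on parameters $y=\rho$. For $n\le N$ the connection coefficients $\mathsf k^\tau_{\nu,\mu}$ ($|\nu|=|\mu|=n$) are defined by the polynomial identities $$\mathsf K_\nu(\tau x;\tau\rho,N)=\sum_{|\mu|=n}\mathsf k^\tau_{\nu,\mu}\,\mathsf K_\mu(x;\rho,N),\qquad x\in\mathbb R^d,$$ and normalized by $\widehat{\mathsf k}^\tau_{\nu,\mu}(\rho)=\sqrt{\mathsf C_\mu(\rho,N)/\mathsf C_\nu(\tau\rho,N)}\;\mathsf k^\tau_{\nu,\mu}$. **Theorem.** Let $\rho_1,\dots,\rho_d\in(0,1)$ with $|\rho|<1$, and let $0\le n\le N$. For $1\le j\le d-1$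 put $$\widehat\rho_j=\frac{\rho_1\rho_{j+1}}{(1-\rho_1)(1+\rho_1-|\boldsymbol\rho_{j+1}|)(1+\rho_1-|\boldsymbol\rho_j|)},\qquad \tilde\rho_j=\frac{\rho_1\rho_{d+1-j}(1-|\rho|)}{(1-|\boldsymbol\rho_{d-j}|)(1-|\boldsymbol\rho_{d+1-j}|)(1+\rho_1-|\rho|)}.$$ Then $\widehat\rho,\tilde\rho\in\mathbb R^{d-1}$ are again admissible parameters (entries in $(0,1)$, sum less than $1$), the connection coefficients for $\tau=(1\,2\cdots d)$ exist, and for all $\nu,\mu\in\mathbb N_0^d$ with $|\nu|=|\mu|=n$, $$\widehat{\mathsf k}^{(12\cdots d)}_{\nu,\mu}(\rho)=(-1)^{n+\nu_d}\sqrt{\mathsf K_{\widehat\rho,n}(\nu_1,\dots,\nu_{d-1})}\;\widehat{\mathsf K}_{(\mu_2,\dots,\mu_d)}\big((\nu_1,\dots,\nu_{d-1});\widehat\rho,n\big)$$ and $$\widehat{\mathsf k}^{(12\cdots d)}_{\nu,\mu}(\rho)=(-1)^{n+\nu_d}\sqrt{\mathsf K_{\tilde\rho,n}(\mu_d,\mu_{d-1},\dots,\mu_2)}\;\widehat{\mathsf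 K}_{(\nu_{d-1},\dots,\nu_1)}\big((\mu_d,\mu_{d-1},\dots,\mu_2);\tilde\rho,n\big).$$ -/

import Mathlib

open Finset

noncomputable section

namespace Krawtchouk

/-- The rising factorial `(a)_k = a (a + 1) ⋯ (a + k - 1)`. -/
def poch (a : ℝ) (k : ℕ) : ℝ := (ascPochhammer ℝ k).eval a

/-- The sum `y_1 + ⋯ + y_j` of the first `j` entries of `y`. -/
def headSum {M : Type*} [AddCommMonoid M] {d : ℕ} (y : Fin d → M) (j : ℕ) : M :=
  ∑ i ∈ univ.filter (fun i : Fin d => i.val < j), y i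

/-- The sum `y_{j+1} + ⋯ + y_d` of the entries of `y` after the first `j`. -/
def tailSum {M : Type*} [AddCommMonoid M] {d : ℕ} (y : Fin d → M) (j : ℕ) : M :=
  ∑ i ∈ univ.filter (fun i : Fin d => j ≤ i.val), y i

/-- Admissible parameters: `0 < ρ_i < 1` for all `i` and `ρ_1 + ⋯ + ρ_d < 1`. -/
def IsParam {d : ℕ} (ρ : Fin d → ℝ) : Prop :=
  (∀ i, 0 < ρ i ∧ ρ i < 1) ∧ ∑ i, ρ i < 1

/-- The polynomial `(c)_m ₂F₁(-m, -y; c; z)`, written so that it makes sense (as the polynomial in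
`c` that it is) also where `c` is a non-positive integer:
`(c)_m / (c)_k = (c + k)_{m - k}` for `k ≤ m`. -/
def factor (m : ℕ) (y c z : ℝ) : ℝ :=
  ∑ k ∈ range (m + 1),
    poch (-(m : ℝ)) k * poch (-y) k * poch (c + k) (m - k) / (k.factorial : ℝ) * z ^ k

/-- Where `(c)_m ≠ 0`, `factor` is the product of `(c)_m` and the terminating hypergeometric sum. -/
theorem factor_eq (m : ℕ) (y c z : ℝ) (hc : poch c m ≠ 0) :
    factor m y c z = poch c m *
      ∑ k ∈ range (m + 1),
        poch (-(m : ℝ)) k * poch (-y) k / (poch c k * (k.factorial : ℝ)) * z ^ k := by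
  unfold factor
  rw [Finset.mul_sum]
  refine Finset.sum_congr rfl fun k hk => ?_
  have hkm : k ≤ m := Nat.lt_succ_iff.mp (Finset.mem_range.mp hk)
  have h : poch c m = poch c k * poch (c + k) (m - k) := by
    have := congrArg (Polynomial.eval c) (ascPochhammer_mul ℝ k (m - k))
    rw [Nat.add_sub_cancel' hkm] at this
    simpa [poch, Polynomial.eval_mul, Polynomial.eval_comp] using this.symm
  have hk0 : poch c k ≠ 0 := fun h0 => hc (by rw [h, h0, zero_mul])
  rw [h]
  field_simp

/-- The multivariable Krawtchouk polynomial `K_ν(x; ρ, N)`. -/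
def poly {d : ℕ} (ν : Fin d → ℕ) (x : Fin d → ℝ) (ρ : Fin d → ℝ) (N : ℕ) : ℝ :=
  1 / poch (-(N : ℝ)) (∑ i, ν i) *
    ∏ j : Fin d, factor (ν j) (x j)
      (-(N : ℝ) + headSum x j + (tailSum ν ((j : ℕ) + 1) : ℕ)) ((1 - headSum ρ j) / ρ j)

/-- The Krawtchouk (multinomial) weight, for `x ∈ ℕ^d` with `|x| ≤ N`. -/
def weight {d : ℕ} (ρ : Fin d → ℝ) (N : ℕ) (x : Fin d → ℕ) : ℝ :=
  (N.factorial : ℝ) * (∏ i, ρ i ^ x i / ((x i).factorial : ℝ)) *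
    ((1 - ∑ i, ρ i) ^ (N - ∑ i, x i) / ((N - ∑ i, x i).factorial : ℝ))

/-- The lattice points `x ∈ ℕ^d` with `|x| ≤ N`. -/
def grid (d N : ℕ) : Finset (Fin d → ℕ) :=
  (Fintype.piFinset fun _ => range (N + 1)).filter fun x => ∑ i, x i ≤ N

theorem mem_grid {d N : ℕ} (x : Fin d → ℕ) : x ∈ grid d N ↔ ∑ i, x i ≤ N := by
  simp only [grid, mem_filter, Fintype.mem_piFinset, mem_range, and_iff_right_iff_imp]
  exact fun h i => Nat.lt_succ_of_le ((single_le_sum (fun _ _ => Nat.zero_le _) (mem_univ i)).trans h)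

/-- The inner product `⟨f, g⟩ = ∑_{x ∈ ℕ^d, |x| ≤ N} f(x) g(x) K_{ρ,N}(x)`. -/
def innerProd {d : ℕ} (ρ : Fin d → ℝ) (N : ℕ) (f g : (Fin d → ℝ) → ℝ) : ℝ :=
  ∑ x ∈ grid d N, f (fun i => (x i : ℝ)) * g (fun i => (x i : ℝ)) * weight ρ N x

/-- The squared norm `C_ν(ρ, N) = ⟨K_ν, K_ν⟩`. -/
def normSq {d : ℕ} (ν : Fin d → ℕ) (ρ : Fin d → ℝ) (N : ℕ) : ℝ :=
  innerProd ρ N (fun x => poly ν x ρ N) (fun x => poly ν x ρ N)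

/-- The orthonormal Krawtchouk polynomial `C_ν(ρ, N)^{-1/2} K_ν(x; ρ, N)`. -/
def polyHat {d : ℕ} (ν : Fin d → ℕ) (x : Fin d → ℝ) (ρ : Fin d → ℝ) (N : ℕ) : ℝ :=
  (Real.sqrt (normSq ν ρ N))⁻¹ * poly ν x ρ N

/-- The first `d` entries of `τ(x_1, …, x_d, s - |x|)`, where `(τ X)_i = X_{τ(i)}`. It is used with
`s = N` for points `x` and with `s = 1` for parameters `ρ`. -/
def act {d : ℕ} (τ : Equiv.Perm (Fin (d + 1))) (s : ℝ) (x : Fin d → ℝ) : Fin d → ℝ :=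
  fun i => (Fin.snoc x (s - ∑ j, x j) : Fin (d + 1) → ℝ) (τ i.castSucc)

/-- `k` is a family of connection coefficients in degree `n`: for all `|ν| = n`,
`K_ν(τ x; τ ρ, N) = ∑_{|μ| = n} k_{ν,μ} K_μ(x; ρ, N)` as polynomials in `x`. -/
def IsConnectionCoeff {d : ℕ} (τ : Equiv.Perm (Fin (d + 1))) (ρ : Fin d → ℝ) (N n : ℕ)
    (k : (Fin d → ℕ) → (Fin d → ℕ) → ℝ) : Prop :=
  ∀ ν : Fin d → ℕ, ∑ i, ν i = n → ∀ x : Fin d → ℝ,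
    poly ν (act τ N x) (act τ 1 ρ) N =
      ∑ μ ∈ Finset.Nat.antidiagonalTuple d n, k ν μ * poly μ x ρ N

/-- The normalized coefficient `√(C_μ(ρ, N) / C_ν(τ ρ, N)) k_{ν,μ}`. -/
def normalized {d : ℕ} (τ : Equiv.Perm (Fin (d + 1))) (ρ : Fin d → ℝ) (N : ℕ)
    (k : (Fin d → ℕ) → (Fin d → ℕ) → ℝ) (ν μ : Fin d → ℕ) : ℝ :=
  Real.sqrt (normSq μ ρ N / normSq ν (act τ 1 ρ) N) * k ν μ

/-- The cyclic permutation `(1 2 … d)` in `S_{d+1}`, with `d = m + 1`. -/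
def cyclicPerm (m : ℕ) : Equiv.Perm (Fin (m + 2)) := Fin.cycleRange (Fin.last m).castSucc

/-- `(1 2 … d)(X_1, …, X_{d+1}) = (X_2, …, X_d, X_1, X_{d+1})`: on the first `d` entries. -/
theorem act_cyclicPerm (m : ℕ) (s : ℝ) (x : Fin (m + 1) → ℝ) :
    act (cyclicPerm m) s x = Fin.snoc (Fin.tail x) (x 0) := by
  funext i
  refine Fin.lastCases ?_ (fun j => ?_) i
  · have : cyclicPerm m (Fin.last m).castSucc = (0 : Fin (m + 1)).castSucc := by
      simp [cyclicPerm]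
    simp only [act, this, Fin.snoc_castSucc, Fin.snoc_last]
  · have : cyclicPerm m j.castSucc.castSucc = j.succ.castSucc := by
      rw [cyclicPerm, Fin.cycleRange_of_lt (by simp [Fin.lt_def])]
      ext
      simp
    simp only [act, this, Fin.snoc_castSucc, Fin.tail]

/-- The parameters
`ρ̂_j = ρ_1 ρ_{j+1} / ((1 - ρ_1)(1 + ρ_1 - |ρ_{j+1}|)(1 + ρ_1 - |ρ_j|))`, `1 ≤ j ≤ d - 1`,
where `|ρ_j| = ρ_1 + ⋯ + ρ_j` and `d = m + 1`; the index `j - 1` is `i`. -/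
def rhoHat {m : ℕ} (ρ : Fin (m + 1) → ℝ) : Fin m → ℝ := fun i =>
  ρ 0 * ρ i.succ /
    ((1 - ρ 0) * (1 + ρ 0 - headSum ρ ((i : ℕ) + 2)) * (1 + ρ 0 - headSum ρ ((i : ℕ) + 1)))

/-- The parameters
`ρ̃_j = ρ_1 ρ_{d+1-j} (1 - |ρ|) / ((1 - |ρ_{d-j}|)(1 - |ρ_{d+1-j}|)(1 + ρ_1 - |ρ|))`,
`1 ≤ j ≤ d - 1`, with `d = m + 1`; the index `j - 1` is `i`, so that `d - j = i.rev + 1`. -/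
def rhoTilde {m : ℕ} (ρ : Fin (m + 1) → ℝ) : Fin m → ℝ := fun i =>
  ρ 0 * ρ i.rev.succ * (1 - ∑ j, ρ j) /
    ((1 - headSum ρ ((i.rev : ℕ) + 1)) * (1 - headSum ρ ((i.rev : ℕ) + 2)) * (1 + ρ 0 - ∑ j, ρ j))

end Krawtchouk

end

noncomputable section

namespace Krawtchouk

/-! Adjoin to `x` the coordinate `N - |x|`. The product over `i` of `(A v)_i ^ x_i`, where `A` is
the matrix `krawMat (zpar ρ)`, generates the Krawtchouk polynomials (`prod_krawMat_mulVec_pow`). So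
up to factorials they are the matrix entries `symCoeff` of a symmetric power of `A`, and identities
between matrices turn into identities between polynomials: products give sums over intermediate
exponents, and transposition only moves factorials (`symCoeff_mul`, `symCoeff_transpose`). The
columns of `A` are orthogonal for the weights `extParam ρ`, which yields orthogonality, norms and
uniqueness of connection coefficients.

A permutation of the coordinates permutes the rows of `A`. The first column of `A` consists of ones,
so the matrices of `τρ` and `ρ` are related by a block matrix `1 ⊕ B`, and the connection
coefficients of degree `n` are entries of the `n`-th symmetric power of `B`. For the cycle, `B =
transMat ρ` (`krawMat_rotate`). The theorem rests on the fact that this `B` is again a Krawtchouk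
matrix up to diagonal factors: it is the transpose of the one for `ρ̂`, and also the one for `ρ̃`
with rows and columns reversed (`transMat_eq`). The first description makes `ν` the point and `μ`
the degree, the second the other way round.

Once `B` is normalized by the column norms, the squares of its first row are the extended `ρ̂`, and
those of its last column are the extended `ρ̃` in reverse order. This is why the diagonal factors
combine into the weight and the norm. The sign comes from the negative scale factors. -/

/-- Two homogeneous polynomial functions of the same degree agree only if their coefficients do. -/
theorem eq_of_sum_monomials {e M : ℕ} {f g : (Fin e → ℕ) → ℝ}
    (h : ∀ v : Fin e → ℝ, ∑ ν ∈ Nat.antidiagonalTuple e M, f ν * ∏ i, v i ^ ν i =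
      ∑ ν ∈ Nat.antidiagonalTuple e M, g ν * ∏ i, v i ^ ν i)
    {ν : Fin e → ℕ} (hν : ∑ i, ν i = M) : f ν = g ν := by
  let p (f : (Fin e → ℕ) → ℝ) : MvPolynomial (Fin e) ℝ :=
    ∑ ν ∈ Nat.antidiagonalTuple e M,
      MvPolynomial.monomial (Finsupp.equivFunOnFinite.symm ν) (f ν)
  have hp : p f = p g := by
    apply MvPolynomial.funext
    intro v
    simpa [p, map_sum, MvPolynomial.eval_monomial, Finsupp.prod_fintype] using h v
  have hc (f : (Fin e → ℕ) → ℝ) :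
      MvPolynomial.coeff (Finsupp.equivFunOnFinite.symm ν) (p f) = f ν := by
    simp [p, MvPolynomial.coeff_sum, MvPolynomial.coeff_monomial, Nat.mem_antidiagonalTuple, hν]
  rw [← hc f, ← hc g, hp]

/-! ### Symmetric powers of a matrix. -/

/-- The coefficient of `v ^ ν` in `∏ i, (A v)_i ^ x_i`: a matrix entry of a symmetric power
of `A`. -/
def symCoeff {e : ℕ} (A : Matrix (Fin e) (Fin e) ℝ) (x ν : Fin e → ℕ) : ℝ :=
  MvPolynomial.coeff (Finsupp.equivFunOnFinite.symm ν)
    (∏ i, (∑ j, MvPolynomial.C (A i j) * MvPolynomial.X j) ^ x i : MvPolynomial (Fin e) ℝ)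

theorem prod_mulVec_pow {e M : ℕ} (A : Matrix (Fin e) (Fin e) ℝ) {x : Fin e → ℕ}
    (hx : ∑ i, x i = M) (v : Fin e → ℝ) :
    ∏ i, A.mulVec v i ^ x i =
      ∑ ν ∈ Nat.antidiagonalTuple e M, symCoeff A x ν * ∏ j, v j ^ ν j := by
  set p : MvPolynomial (Fin e) ℝ :=
    ∏ i, (∑ j, MvPolynomial.C (A i j) * MvPolynomial.X j) ^ x i with hp
  have hom : p.IsHomogeneous M := by
    rw [← hx]
    apply MvPolynomial.IsHomogeneous.prod
    intro i _
    simpa using (MvPolynomial.IsHomogeneous.sum univ _ 1 fun j _ => by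
      simpa using (MvPolynomial.isHomogeneous_C (Fin e) (A i j)).mul
        (MvPolynomial.isHomogeneous_X ℝ j)).pow (x i)
  have h1 : MvPolynomial.eval v p = ∏ i, A.mulVec v i ^ x i := by
    simp [hp, map_prod, map_sum, Matrix.mulVec, dotProduct]
  rw [← h1, MvPolynomial.eval_eq']
  -- The support contains only exponents with nonzero coefficient, so the two sums are matched on
  -- their nonzero terms.
  refine Finset.sum_bij_ne_zero (fun d _ _ => (d : Fin e → ℕ)) ?_ ?_ ?_ ?_
  · intro d hd _
    rw [Nat.mem_antidiagonalTuple]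
    have := hom (MvPolynomial.mem_support_iff.1 hd)
    simpa [Finsupp.weight_apply, Finsupp.sum_fintype] using this
  · intro a _ _ b _ _ h
    exact DFunLike.coe_injective h
  · intro ν _ hne
    refine ⟨Finsupp.equivFunOnFinite.symm ν, ?_, ?_, by simp⟩
    · rw [MvPolynomial.mem_support_iff]
      exact left_ne_zero_of_mul hne
    · exact hne
  · intro d _ _
    have hd : Finsupp.equivFunOnFinite.symm (d : Fin e → ℕ) = d := by ext; rfl
    rw [symCoeff, hd]

theorem symCoeff_eq_of_forall {e M : ℕ} {A : Matrix (Fin e) (Fin e) ℝ} {x : Fin e → ℕ}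
    (hx : ∑ i, x i = M) {f : (Fin e → ℕ) → ℝ}
    (h : ∀ v : Fin e → ℝ, ∏ i, A.mulVec v i ^ x i =
      ∑ ν ∈ Nat.antidiagonalTuple e M, f ν * ∏ j, v j ^ ν j)
    {ν : Fin e → ℕ} (hν : ∑ i, ν i = M) : symCoeff A x ν = f ν :=
  eq_of_sum_monomials (fun v => by rw [← prod_mulVec_pow A hx, h]) hν

/-- Functoriality: expand in the coordinates of `B v` first, then in those of `v`. -/
theorem symCoeff_mul {e M : ℕ} (A B : Matrix (Fin e) (Fin e) ℝ) {x ν : Fin e → ℕ}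
    (hx : ∑ i, x i = M) (hν : ∑ i, ν i = M) :
    symCoeff (A * B) x ν =
      ∑ μ ∈ Nat.antidiagonalTuple e M, symCoeff A x μ * symCoeff B μ ν := by
  refine symCoeff_eq_of_forall hx
    (f := fun ν => ∑ μ ∈ Nat.antidiagonalTuple e M, symCoeff A x μ * symCoeff B μ ν)
    (fun v => ?_) hν
  rw [← Matrix.mulVec_mulVec, prod_mulVec_pow A hx]
  simp_rw [sum_mul]
  rw [sum_comm]
  refine sum_congr rfl fun μ hμ => ?_
  rw [prod_mulVec_pow B (Nat.mem_antidiagonalTuple.1 hμ), mul_sum]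
  exact sum_congr rfl fun _ _ => by ring

theorem symCoeff_scale {e M : ℕ} (A : Matrix (Fin e) (Fin e) ℝ) (r t : Fin e → ℝ)
    {x ν : Fin e → ℕ} (hx : ∑ i, x i = M) (hν : ∑ i, ν i = M) :
    symCoeff (Matrix.of fun i j => r i * t j * A i j) x ν =
      (∏ i, r i ^ x i) * (∏ j, t j ^ ν j) * symCoeff A x ν := by
  refine symCoeff_eq_of_forall hx
    (f := fun ν => (∏ i, r i ^ x i) * (∏ j, t j ^ ν j) * symCoeff A x ν) (fun v => ?_) hν
  have h : ∀ i, (Matrix.of fun i j => r i * t j * A i j).mulVec v i =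
      r i * A.mulVec (fun j => t j * v j) i := fun i => by
    simp only [Matrix.mulVec, dotProduct, Matrix.of_apply, mul_sum]
    exact sum_congr rfl fun _ _ => by ring
  simp_rw [h, mul_pow, prod_mul_distrib]
  rw [prod_mulVec_pow A hx, mul_sum]
  refine sum_congr rfl fun μ _ => ?_
  simp_rw [mul_pow, prod_mul_distrib]
  ring

theorem symCoeff_reindex {e M : ℕ} (A : Matrix (Fin e) (Fin e) ℝ) (σ π : Equiv.Perm (Fin e))
    {x ν : Fin e → ℕ} (hx : ∑ i, x i = M) (hν : ∑ i, ν i = M) :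
    symCoeff (A.submatrix σ π) x ν = symCoeff A (x ∘ σ.symm) (ν ∘ π.symm) := by
  have hx' : ∑ i, (x ∘ σ.symm) i = M := by rw [← hx]; exact Equiv.sum_comp σ.symm x
  refine symCoeff_eq_of_forall hx (f := fun ν => symCoeff A (x ∘ σ.symm) (ν ∘ π.symm))
    (fun v => ?_) hν
  have h : ∀ i, (A.submatrix σ π).mulVec v i = A.mulVec (v ∘ π.symm) (σ i) := fun i => by
    simp only [Matrix.mulVec, dotProduct, Matrix.submatrix_apply]
    rw [← Equiv.sum_comp π (fun j => A (σ i) j * (v ∘ π.symm) j)]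
    simp
  have h2 : ∏ i, (A.submatrix σ π).mulVec v i ^ x i =
      ∏ i, A.mulVec (v ∘ π.symm) i ^ (x ∘ σ.symm) i := by
    rw [← Equiv.prod_comp σ (fun i => A.mulVec (v ∘ π.symm) i ^ (x ∘ σ.symm) i)]
    simp [h]
  rw [h2, prod_mulVec_pow A hx']
  refine Finset.sum_bij (fun ν _ => ν ∘ π) ?_ ?_ ?_ ?_
  · intro ν hν
    rw [Nat.mem_antidiagonalTuple] at hν ⊢
    rw [← hν]
    exact Equiv.sum_comp π ν
  · intro a _ b _ h
    funext i
    simpa using congrFun h (π.symm i)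
  · intro ν hν
    refine ⟨ν ∘ π.symm, ?_, ?_⟩
    · rw [Nat.mem_antidiagonalTuple] at hν ⊢
      rw [← hν]
      exact Equiv.sum_comp π.symm ν
    · funext i; simp
  · intro ν _
    have : (ν ∘ π) ∘ π.symm = ν := by funext i; simp
    rw [this]
    congr 1
    rw [← Equiv.prod_comp π]
    simp

theorem sum_pow_eq_sum_antidiagonalTuple {e : ℕ} (f : Fin e → ℝ) (M : ℕ) :
    (∑ i, f i) ^ M = ∑ x ∈ Nat.antidiagonalTuple e M,
      (M.factorial : ℝ) / (∏ i, ((x i).factorial : ℝ)) * ∏ i, f i ^ x i := by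
  rw [sum_pow_eq_sum_piAntidiag]
  refine sum_congr (by ext; simp [Nat.mem_antidiagonalTuple]) fun x hx => ?_
  congr 1
  rw [eq_div_iff (by positivity), mul_comm]
  have := Nat.multinomial_spec univ x
  rw [Nat.mem_antidiagonalTuple.1 hx] at this
  exact_mod_cast this

/-- Both sides come from the coefficient of `u ^ x * v ^ ν` in the `M`-th power of the bilinear form
`u ⬝ A v = v ⬝ Aᵀ u`, expanded by the multinomial theorem in either way. -/
theorem symCoeff_transpose {e M : ℕ} (A : Matrix (Fin e) (Fin e) ℝ) {x ν : Fin e → ℕ}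
    (hx : ∑ i, x i = M) (hν : ∑ i, ν i = M) :
    (∏ i, ((ν i).factorial : ℝ)) * symCoeff A x ν =
      (∏ i, ((x i).factorial : ℝ)) * symCoeff A.transpose ν x := by
  have key (A : Matrix (Fin e) (Fin e) ℝ) (u v : Fin e → ℝ) :
      (∑ i, u i * A.mulVec v i) ^ M = ∑ x ∈ Nat.antidiagonalTuple e M,
        (∑ ν ∈ Nat.antidiagonalTuple e M,
          (M.factorial : ℝ) / (∏ i, ((x i).factorial : ℝ)) * symCoeff A x ν * ∏ i, v i ^ ν i) *
          ∏ i, u i ^ x i := by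
    rw [sum_pow_eq_sum_antidiagonalTuple]
    refine sum_congr rfl fun x hx => ?_
    simp_rw [mul_pow, prod_mul_distrib]
    rw [prod_mulVec_pow A (Nat.mem_antidiagonalTuple.1 hx), mul_sum, mul_sum, sum_mul]
    exact sum_congr rfl fun _ _ => by ring
  have swap (u v : Fin e → ℝ) : ∑ i, u i * A.mulVec v i = ∑ i, v i * A.transpose.mulVec u i := by
    simp only [Matrix.mulVec, dotProduct, mul_sum, Matrix.transpose_apply]
    rw [sum_comm]
    exact sum_congr rfl fun _ _ => sum_congr rfl fun _ _ => by ring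
  -- Coefficients are compared in `u` for fixed `v`, and then in `v`.
  have h1 (v : Fin e → ℝ) := eq_of_sum_monomials (M := M) (ν := x)
    (f := fun x => ∑ ν ∈ Nat.antidiagonalTuple e M,
      (M.factorial : ℝ) / (∏ i, ((x i).factorial : ℝ)) * symCoeff A x ν * ∏ i, v i ^ ν i)
    (g := fun x => ∑ ν ∈ Nat.antidiagonalTuple e M,
      (M.factorial : ℝ) / (∏ i, ((ν i).factorial : ℝ)) * symCoeff A.transpose ν x *
        ∏ i, v i ^ ν i)
    (fun u => by
      rw [← key, swap, key]
      simp_rw [sum_mul]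
      rw [sum_comm]
      exact sum_congr rfl fun _ _ => sum_congr rfl fun _ _ => by ring) hx
  have h2 := eq_of_sum_monomials h1 hν
  have hM : (M.factorial : ℝ) ≠ 0 := by positivity
  have hx0 : (∏ i, ((x i).factorial : ℝ)) ≠ 0 := by positivity
  have hν0 : (∏ i, ((ν i).factorial : ℝ)) ≠ 0 := by positivity
  field_simp at h2
  linarith

/-! ### The generating function in one variable. -/

theorem headSum_zero {e : ℕ} (y : Fin e → ℝ) : headSum y 0 = 0 := by simp [headSum]

theorem headSum_succ {e : ℕ} (y : Fin (e + 1) → ℝ) (j : ℕ) :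
    headSum y (j + 1) = y 0 + headSum (Fin.tail y) j := by
  simp only [headSum, sum_filter, Fin.sum_univ_succ, Fin.tail]
  simp

theorem tailSum_zero {e : ℕ} (y : Fin e → ℕ) : tailSum y 0 = ∑ i, y i := by simp [tailSum]

theorem tailSum_succ {e : ℕ} (y : Fin (e + 1) → ℕ) (j : ℕ) :
    tailSum y (j + 1) = tailSum (Fin.tail y) j := by
  simp only [tailSum, sum_filter, Fin.sum_univ_succ, Fin.tail]
  simp

theorem poch_neg_natCast (n k : ℕ) :
    poch (-(n : ℝ)) k = (-1) ^ k * ((k.factorial : ℝ) * (n.choose k : ℝ)) := by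
  rw [poch, ascPochhammer_eval_neg_eq_descPochhammer, descPochhammer_eval_eq_descFactorial,
    Nat.descFactorial_eq_factorial_mul_choose]
  push_cast
  rfl

/-- At these arguments every Pochhammer symbol is taken at a non-positive integer or, for `k > y`,
multiplied by zero; each one that survives is a signed binomial coefficient times a factorial. -/
theorem factor_natCast (m y K : ℕ) (z : ℝ) :
    (-1) ^ m / (m.factorial : ℝ) * factor m y (-((y : ℝ) + K)) z =
      ∑ k ∈ range (m + 1), (y.choose k : ℝ) * (-z) ^ k * ((y + K - k).choose (m - k) : ℝ) := by
  rw [factor, mul_sum]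
  refine sum_congr rfl fun k hk => ?_
  have hkm : k ≤ m := Nat.lt_succ_iff.mp (mem_range.mp hk)
  rcases Nat.lt_or_ge y k with h | h
  · simp [poch_neg_natCast, Nat.choose_eq_zero_of_lt h]
  · have hc : -((y : ℝ) + K) + k = -((y + K - k : ℕ) : ℝ) := by
      rw [Nat.cast_sub (by omega)]; push_cast; ring
    rw [hc, poch_neg_natCast, poch_neg_natCast, poch_neg_natCast, neg_pow z]
    have hf : (m.choose k : ℝ) * k.factorial * (m - k).factorial = m.factorial := by
      exact_mod_cast Nat.choose_mul_factorial_mul_factorial hkm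
    have hs : (-1 : ℝ) ^ m * (-1) ^ (m - k) = (-1) ^ k := by
      rw [← pow_add, show m + (m - k) = k + 2 * (m - k) by omega, pow_add, pow_mul]; simp
    have hs2 : (-1 : ℝ) ^ k * (-1) ^ k = 1 := by rw [← mul_pow]; simp
    have hm : (m.factorial : ℝ) ≠ 0 := by positivity
    have hk0 : (k.factorial : ℝ) ≠ 0 := by positivity
    generalize (-1 : ℝ) ^ m = a at *
    generalize (-1 : ℝ) ^ (m - k) = b at *
    generalize (-1 : ℝ) ^ k = c at *
    field_simp
    rw [← hf]
    linear_combination ((k.factorial : ℝ) * (y.choose k) * z ^ k *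
      (m.choose k) * ((m - k).factorial) * ((y + K - k).choose (m - k))) * (a * b * hs2 + hs)

theorem factor_natCast_eq_zero {m y K : ℕ} (h : y + K < m) (z : ℝ) :
    factor m y (-((y : ℝ) + K)) z = 0 := by
  have h0 : (-1) ^ m / (m.factorial : ℝ) ≠ 0 := by positivity
  have h1 := factor_natCast m y K z
  rw [sum_eq_zero, mul_eq_zero] at h1
  · exact h1.resolve_left h0
  · intro k hk
    rcases Nat.lt_or_ge y k with h | h
    · simp [Nat.choose_eq_zero_of_lt h]
    · rw [Nat.choose_eq_zero_of_lt (show y + K - k < m - k by omega)]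
      simp

/-- Write `u + (1 - z) v = -z v + (u + v)`. Expand its `y`-th power in `-z v`, then the remaining
power `y - k + K` of `u + v`, and collect the powers of `v` by `factor_natCast`. -/
theorem factor_generating (y K : ℕ) (z u v : ℝ) :
    (u + (1 - z) * v) ^ y * (u + v) ^ K = ∑ m ∈ range (y + K + 1),
      (-1) ^ m / (m.factorial : ℝ) * factor m y (-((y : ℝ) + K)) z *
        (u ^ (y + K - m) * v ^ m) := by
  have h1 : (u + (1 - z) * v) ^ y = ∑ k ∈ range (y + K + 1),
      ((-z * v) ^ k * (u + v) ^ (y - k) * (y.choose k : ℝ)) := by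
    rw [show u + (1 - z) * v = -z * v + (u + v) by ring, add_pow]
    refine sum_subset (range_mono (by omega)) fun k _ hk => ?_
    rw [Nat.choose_eq_zero_of_lt (by simpa using hk)]
    simp
  simp_rw [factor_natCast, h1, sum_mul]
  rw [sum_comm' (t' := range (y + K + 1)) (s' := fun k => Ico k (y + K + 1))
    (by intro a b; simp only [mem_range, mem_Ico]; omega)]
  refine sum_congr rfl fun k hk => ?_
  rcases Nat.lt_or_ge y k with h | h
  · simp [Nat.choose_eq_zero_of_lt h]
  rw [sum_Ico_eq_sum_range, show y + K + 1 - k = (y + K - k) + 1 by omega]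
  have h2 : (u + v) ^ (y - k) * (u + v) ^ K = ∑ l ∈ range (y + K - k + 1),
      v ^ l * u ^ (y + K - k - l) * ((y + K - k).choose l : ℝ) := by
    rw [← pow_add, show y - k + K = y + K - k by omega, add_comm u v, add_pow]
  calc _ = (-z * v) ^ k * (y.choose k : ℝ) * ((u + v) ^ (y - k) * (u + v) ^ K) := by ring
    _ = _ := by
      rw [h2, mul_sum]
      refine sum_congr rfl fun l _ => ?_
      rw [Nat.add_sub_cancel_left, Nat.sub_sub, mul_pow, pow_add]
      ring

/-! ### The generating function in several variables. -/

/-- The coefficients of the generating function of the Krawtchouk polynomials, as polynomials in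
`x` and `T`. -/
def genCoeff {e : ℕ} (z : Fin e → ℝ) (ν : Fin e → ℕ) (x : Fin e → ℝ) (T : ℝ) : ℝ :=
  ∏ j : Fin e, (-1) ^ ν j / ((ν j).factorial : ℝ) *
    factor (ν j) (x j) (-T + headSum x j + (tailSum ν ((j : ℕ) + 1) : ℕ)) (z j)

theorem genCoeff_succ {e : ℕ} (z : Fin (e + 1) → ℝ) (ν : Fin (e + 1) → ℕ) (x : Fin (e + 1) → ℝ)
    (T : ℝ) : genCoeff z ν x T = (-1) ^ ν 0 / ((ν 0).factorial : ℝ) *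
      factor (ν 0) (x 0) (-T + (∑ i, Fin.tail ν i : ℕ)) (z 0) *
      genCoeff (Fin.tail z) (Fin.tail ν) (Fin.tail x) (T - x 0) := by
  rw [genCoeff, Fin.prod_univ_succ, genCoeff]
  congr 1
  · simp [headSum_zero, tailSum_succ, tailSum_zero]
  · refine prod_congr rfl fun j _ => ?_
    rw [Fin.val_succ, headSum_succ, tailSum_succ]
    simp only [Fin.tail]
    congr 2
    ring

/-- If the tail of `ν` is already too large for `T - x 0`, induction applies; otherwise `ν 0`
exceeds the degree `T - |tail ν|` in the one-variable generating function, and the first factor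
vanishes. -/
theorem genCoeff_eq_zero {e : ℕ} (z : Fin e → ℝ) (ν x : Fin e → ℕ) {T : ℕ} (hx : ∑ i, x i ≤ T)
    (hν : T < ∑ i, ν i) : genCoeff z ν (fun i => (x i : ℝ)) T = 0 := by
  induction e generalizing T with
  | zero => simp at hν
  | succ e ih =>
    rw [Fin.sum_univ_succ] at hx hν
    rw [genCoeff_succ]
    have hT : (T : ℝ) - x 0 = ((T - x 0 : ℕ) : ℝ) := by rw [Nat.cast_sub (by omega)]
    rcases Nat.lt_or_ge (T - x 0) (∑ i, Fin.tail ν i) with h | h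
    · have := ih (Fin.tail z) (Fin.tail ν) (Fin.tail x) (T := T - x 0)
        (by simp only [Fin.tail]; omega) h
      rw [hT]
      exact mul_eq_zero_of_right _ this
    · have hc : -(T : ℝ) + (∑ i, Fin.tail ν i : ℕ) =
          -((x 0 : ℝ) + (T - x 0 - ∑ i, Fin.tail ν i : ℕ)) := by
        rw [Nat.cast_sub h, Nat.cast_sub (by omega)]; ring
      rw [hc, factor_natCast_eq_zero]
      · simp
      · simp only [Fin.tail] at h ⊢
        omega

/-- The matrix of the linear forms in the generating function, whose first column belongs to the
homogenizing variable. -/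
def krawMat {e : ℕ} (z : Fin e → ℝ) : Matrix (Fin (e + 1)) (Fin (e + 1)) ℝ :=
  Matrix.of fun i j => Fin.cases 1
    (fun k : Fin e => if (k : ℕ) < i then 1 else if (k : ℕ) = i then 1 - z k else 0) j

theorem krawMat_zero {e : ℕ} (z : Fin e → ℝ) (i : Fin (e + 1)) : krawMat z i 0 = 1 := rfl

theorem krawMat_succ {e : ℕ} (z : Fin e → ℝ) (i : Fin (e + 1)) (k : Fin e) :
    krawMat z i k.succ = if (k : ℕ) < i then 1 else if (k : ℕ) = i then 1 - z k else 0 := rfl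

theorem krawMat_mulVec_zero {e : ℕ} (z : Fin (e + 1) → ℝ) (v : Fin (e + 2) → ℝ) :
    (krawMat z).mulVec v 0 = v 0 + (1 - z 0) * v 1 := by
  simp only [Matrix.mulVec, dotProduct]
  rw [Fin.sum_univ_succ, Fin.sum_univ_succ]
  rw [krawMat_succ, krawMat_zero]
  simp [krawMat_succ]

/-- All rows but the first contain `v 0` and `v 1` only through their sum, which becomes the
homogenizing variable for one dimension less. -/
theorem krawMat_mulVec_succ {e : ℕ} (z : Fin (e + 1) → ℝ) (v : Fin (e + 2) → ℝ)
    (i : Fin (e + 1)) : (krawMat z).mulVec v i.succ =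
      (krawMat (Fin.tail z)).mulVec
        (Fin.cons (v 0 + v 1) (Fin.tail (Fin.tail v))) i := by
  simp only [Matrix.mulVec, dotProduct]
  rw [Fin.sum_univ_succ, Fin.sum_univ_succ, Fin.sum_univ_succ (n := e), ← add_assoc]
  congr 1
  · rw [krawMat_succ, krawMat_zero, krawMat_zero]
    simp
  · simp [krawMat_succ, Fin.tail]

/-- By induction the later rows give a generating function homogenized by `v 0 + v 1`. Each power
`(v 0 + v 1) ^ ν 0` in it combines with the first row's `(v 0 + (1 - z 0) v 1) ^ x 0` through
`factor_generating`. -/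
theorem prod_krawMat_mulVec_pow {e M : ℕ} (z : Fin e → ℝ) {x : Fin (e + 1) → ℕ}
    (hx : ∑ i, x i = M) (v : Fin (e + 1) → ℝ) :
    ∏ i, (krawMat z).mulVec v i ^ x i = ∑ ν ∈ Nat.antidiagonalTuple (e + 1) M,
      genCoeff z (Fin.tail ν) (fun i => (x i.castSucc : ℝ)) M * ∏ j, v j ^ ν j := by
  induction e generalizing M with
  | zero =>
    have hx0 : x 0 = M := by simpa using hx
    simp [Nat.antidiagonalTuple_one, genCoeff, Matrix.mulVec, dotProduct, krawMat_zero, hx0]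
  | succ e ih =>
    rw [Fin.prod_univ_succ]
    simp_rw [krawMat_mulVec_succ, krawMat_mulVec_zero]
    rw [Fin.sum_univ_succ] at hx
    obtain ⟨M', hM'⟩ : ∃ M', ∑ i, Fin.tail x i = M' := ⟨_, rfl⟩
    have hMM : x 0 + M' = M := by rw [← hx, ← hM']; rfl
    have := ih (Fin.tail z) hM' (Fin.cons (v 0 + v 1) (Fin.tail (Fin.tail v)))
    simp only [Fin.tail] at this ⊢
    rw [this, mul_sum]
    simp_rw [Fin.prod_univ_succ]
    simp only [Fin.cons_zero, Fin.cons_succ]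
    have hsplit (ν : Fin (e + 1) → ℕ) :
        (v 0 + (1 - z 0) * v 1) ^ x 0 * (genCoeff (fun i => z i.succ) (fun i => ν i.succ)
          (fun i => (x i.castSucc.succ : ℝ)) M' *
            ((v 0 + v 1) ^ ν 0 * ∏ i : Fin e, v i.succ.succ ^ ν i.succ)) =
        ∑ m ∈ range (x 0 + ν 0 + 1), (-1) ^ m / (m.factorial : ℝ) *
          factor m (x 0) (-((x 0 : ℝ) + ν 0)) (z 0) * (v 0 ^ (x 0 + ν 0 - m) * v 1 ^ m) *
          (genCoeff (fun i => z i.succ) (fun i => ν i.succ)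
          (fun i => (x i.castSucc.succ : ℝ)) M' * ∏ i : Fin e, v i.succ.succ ^ ν i.succ) := by
      rw [← sum_mul, ← factor_generating]; ring
    refine (sum_congr rfl fun ν _ => hsplit ν).trans ?_
    have hterm (ν : Fin (e + 1) → ℕ) :
        genCoeff z ν (fun i => (x i.castSucc : ℝ)) M =
        (-1) ^ ν 0 / ((ν 0).factorial : ℝ) *
          factor (ν 0) (x 0) (-M + (∑ i : Fin e, ν i.succ : ℕ)) (z 0) *
          genCoeff (fun i => z i.succ) (fun i => ν i.succ)
          (fun i => (x i.castSucc.succ : ℝ)) M' := by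
      have hM2 : (M' : ℝ) = M - x 0 := by rw [← hMM]; push_cast; ring
      rw [genCoeff_succ, hM2]
      rfl
    -- Of the total degree `x 0 + ν 0` in `v 0` and `v 1`, the part `m` goes to `v 1`.
    let φ (p : (_ : Fin (e + 1) → ℕ) × ℕ) : Fin (e + 2) → ℕ :=
      Fin.cons (x 0 + p.1 0 - p.2) (Fin.cons p.2 (Fin.tail p.1))
    have hval (ν : Fin (e + 1) → ℕ) (m : ℕ) (hν : ∑ i, ν i = M') :
        (-1) ^ m / (m.factorial : ℝ) *
          factor m (x 0) (-((x 0 : ℝ) + ν 0)) (z 0) * (v 0 ^ (x 0 + ν 0 - m) * v 1 ^ m) *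
          (genCoeff (fun i => z i.succ) (fun i => ν i.succ)
          (fun i => (x i.castSucc.succ : ℝ)) M' * ∏ i : Fin e, v i.succ.succ ^ ν i.succ) =
        genCoeff z (fun i => φ ⟨ν, m⟩ i.succ) (fun i => (x i.castSucc : ℝ)) M *
          ∏ j, v j ^ φ ⟨ν, m⟩ j := by
      have hc : -(M : ℝ) + (∑ i : Fin e, ν i.succ : ℕ) = -((x 0 : ℝ) + ν 0) := by
        rw [← hMM, ← hν, Fin.sum_univ_succ]; push_cast; ring
      rw [hterm, Fin.prod_univ_succ, Fin.prod_univ_succ]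
      simp only [φ, Fin.cons_zero, Fin.cons_succ, Fin.tail]
      rw [hc]
      change _ = _ * (_ * (v 1 ^ m * _))
      ring
    rw [sum_sigma']
    -- Exponents whose entries from the third on sum to more than `M'` are not in the image of `φ`;
    -- their coefficients vanish by `genCoeff_eq_zero`.
    refine Finset.sum_bij_ne_zero (fun p _ _ => φ p) ?_ ?_ ?_ ?_
    · rintro ⟨ν, m⟩ h _
      simp only [φ, mem_sigma, Nat.mem_antidiagonalTuple, mem_range, Fin.sum_univ_succ,
        Fin.cons_zero, Fin.cons_succ, Fin.tail] at h ⊢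
      omega
    · rintro ⟨ν, m⟩ h _ ⟨ν', m'⟩ h' _ heq
      simp only [mem_sigma, Nat.mem_antidiagonalTuple, mem_range] at h h'
      obtain ⟨h0, h1⟩ := Fin.cons_inj.1 heq
      obtain ⟨h1, h2⟩ := Fin.cons_inj.1 h1
      dsimp only at h0 h1 h2
      subst h1
      have : ν = ν' := by
        rw [← Fin.cons_self_tail ν, ← Fin.cons_self_tail ν', h2]
        congr 1
        omega
      rw [this]
    · intro ν h hne
      have hq := left_ne_zero_of_mul hne
      rw [hterm] at hq
      have hq2 : ∑ i : Fin e, ν i.succ.succ ≤ M' := by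
        by_contra hcon
        refine right_ne_zero_of_mul hq (genCoeff_eq_zero _ _ (fun i => x i.castSucc.succ) ?_
          (not_le.1 hcon))
        rw [← hM', Fin.sum_univ_castSucc]
        simp [Fin.tail]
      have hs : ν 0 + (ν 1 + ∑ i : Fin e, ν i.succ.succ) = M := by
        simpa [Nat.mem_antidiagonalTuple, Fin.sum_univ_succ] using h
      let ν' : Fin (e + 1) → ℕ :=
        Fin.cons (M' - ∑ i : Fin e, ν i.succ.succ) (fun i => ν i.succ.succ)
      have hν' : ∑ i, ν' i = M' := by
        simp only [ν', Fin.sum_univ_succ, Fin.cons_zero, Fin.cons_succ]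
        omega
      have hφ : φ ⟨ν', ν 1⟩ = ν := by
        funext i
        refine Fin.cases ?_ (fun i => Fin.cases rfl (fun i => rfl) i) i
        simp only [φ, ν', Fin.cons_zero]
        omega
      refine ⟨⟨ν', ν 1⟩, ?_, ?_, hφ⟩
      · simp only [mem_sigma, Nat.mem_antidiagonalTuple, mem_range]
        refine ⟨hν', ?_⟩
        simp only [ν', Fin.cons_zero]
        omega
      · rw [hval _ _ hν', hφ, Fin.prod_univ_succ, Fin.prod_univ_succ]
        exact hne
    · rintro ⟨ν, m⟩ h _
      simp only [mem_sigma, Nat.mem_antidiagonalTuple] at h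
      refine (hval ν m h.1).trans ?_
      rw [Fin.prod_univ_succ, Fin.prod_univ_succ]
      rfl

theorem symCoeff_krawMat {e M : ℕ} (z : Fin e → ℝ) {x ν : Fin (e + 1) → ℕ}
    (hx : ∑ i, x i = M) (hν : ∑ i, ν i = M) :
    symCoeff (krawMat z) x ν = genCoeff z (Fin.tail ν) (fun i => (x i.castSucc : ℝ)) M :=
  symCoeff_eq_of_forall hx
    (f := fun ν => genCoeff z (Fin.tail ν) (fun i => (x i.castSucc : ℝ)) M)
    (prod_krawMat_mulVec_pow z hx) hν

/-! ### Orthogonality, norms and linear independence. -/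

/-- The argument of the hypergeometric series in the Krawtchouk polynomials. -/
def zpar {e : ℕ} (ρ : Fin e → ℝ) : Fin e → ℝ := fun j => (1 - headSum ρ j) / ρ j

theorem poly_eq_genCoeff {e N n : ℕ} (hn : n ≤ N) (ρ x : Fin e → ℝ) {ν : Fin e → ℕ}
    (hν : ∑ i, ν i = n) :
    poly ν x ρ N = ((N - n).factorial : ℝ) * (∏ i, ((ν i).factorial : ℝ)) / (N.factorial : ℝ) *
      genCoeff (zpar ρ) ν x N := by
  have h1 : poch (-(N : ℝ)) n = (-1) ^ n * ((N.factorial : ℝ) / (N - n).factorial) := by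
    rw [poch_neg_natCast, ← Nat.choose_mul_factorial_mul_factorial hn]
    push_cast
    field_simp
  have h2 : ∏ i, ((-1 : ℝ) ^ ν i / ((ν i).factorial : ℝ)) =
      (-1) ^ n / ∏ i, ((ν i).factorial : ℝ) := by
    rw [prod_div_distrib, prod_pow_eq_pow_sum, hν]
  have h3 : ((-1 : ℝ) ^ n) ^ 2 = 1 := by rw [← pow_mul, mul_comm, pow_mul]; simp
  have h4 : (∏ i, ((ν i).factorial : ℝ)) ≠ 0 := by positivity
  rw [poly, genCoeff, prod_mul_distrib, h2, hν, h1]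
  simp only [zpar]
  field_simp
  rw [h3, one_mul]

theorem headSum_add_one {e : ℕ} (y : Fin e → ℝ) (k : Fin e) :
    headSum y ((k : ℕ) + 1) = headSum y k + y k := by
  simp only [headSum, sum_filter]
  rw [← sum_ite_eq_of_mem' univ k y (mem_univ k), ← sum_add_distrib]
  refine sum_congr rfl fun i _ => ?_
  rcases lt_trichotomy (i : ℕ) k with h | h | h
  · rw [if_pos (by omega), if_pos h, if_neg (by rw [Fin.ext_iff]; omega), add_zero]
  · rw [if_pos (by omega), if_neg (by omega), if_pos (by rw [Fin.ext_iff]; omega), zero_add]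
  · rw [if_neg (by omega), if_neg (by omega), if_neg (by rw [Fin.ext_iff]; omega), add_zero]

theorem headSum_self {e : ℕ} (y : Fin e → ℝ) : headSum y e = ∑ i, y i := by
  simp [headSum]

theorem sum_mul_ite {e : ℕ} (y : Fin e → ℝ) (k : Fin e) (f g : ℝ) :
    ∑ i : Fin e, y i * (if (k : ℕ) < i then f else if (k : ℕ) = i then g else 0) =
      (∑ i, y i - headSum y ((k : ℕ) + 1)) * f + y k * g := by
  have h : y k * g = ∑ i, if i = k then y i * g else 0 := by simp
  rw [h, headSum, sum_filter, ← sum_sub_distrib, sum_mul, ← sum_add_distrib]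
  refine sum_congr rfl fun i _ => ?_
  rcases lt_trichotomy (i : ℕ) k with h | h | h
  · rw [if_neg (by omega), if_neg (by omega), if_pos (by omega),
      if_neg (by rw [Fin.ext_iff]; omega)]; ring
  · rw [if_neg (by omega), if_pos (by omega), if_pos (by omega),
      if_pos (by rw [Fin.ext_iff]; omega)]; ring
  · rw [if_pos (by omega), if_neg (by omega), if_neg (by rw [Fin.ext_iff]; omega)]; ring

/-- The parameters together with the last one, `1 - |ρ|`. -/
def extParam {e : ℕ} (ρ : Fin e → ℝ) : Fin (e + 1) → ℝ := Fin.snoc ρ (1 - ∑ i, ρ i)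

theorem extParam_castSucc {e : ℕ} (ρ : Fin e → ℝ) (i : Fin e) :
    extParam ρ i.castSucc = ρ i := by simp [extParam]

theorem extParam_last {e : ℕ} (ρ : Fin e → ℝ) :
    extParam ρ (Fin.last e) = 1 - ∑ i, ρ i := by simp [extParam]

/-- The squared norms of the columns of `krawMat (zpar ρ)`, except the first. -/
def colNorm {e : ℕ} (ρ : Fin e → ℝ) : Fin e → ℝ := fun j =>
  (1 - headSum ρ j) * (1 - headSum ρ ((j : ℕ) + 1)) / ρ j

theorem sum_extParam_mul_ite {e : ℕ} (ρ : Fin e → ℝ) (k : Fin e) (f g : ℝ) :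
    ∑ i : Fin (e + 1), extParam ρ i *
        (if (k : ℕ) < i then f else if (k : ℕ) = i then g else 0) =
      (1 - headSum ρ ((k : ℕ) + 1)) * f + ρ k * g := by
  rw [Fin.sum_univ_castSucc]
  simp_rw [extParam_castSucc, extParam_last, Fin.val_castSucc]
  rw [sum_mul_ite, Fin.val_last, if_pos k.2]
  ring

/-- The value of `zpar ρ k` makes the column `k.succ` orthogonal to the column of ones. For `j < k`
the column `j.succ` is constantly `1` on the support of the column `k.succ`, which reduces that case
to the first. -/
theorem krawMat_orthogonal {e : ℕ} {ρ : Fin e → ℝ} (hρ : IsParam ρ) (j k : Fin (e + 1)) :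
    ∑ i, extParam ρ i * (krawMat (zpar ρ) i j * krawMat (zpar ρ) i k) =
      if j = k then (Fin.cons 1 (colNorm ρ) : Fin (e + 1) → ℝ) j else 0 := by
  have hz (k : Fin e) : 1 - headSum ρ ((k : ℕ) + 1) + ρ k * (1 - zpar ρ k) = 0 := by
    have := (hρ.1 k).1.ne'
    rw [headSum_add_one, zpar]
    field_simp
    ring
  have h0 (k : Fin e) : ∑ i, extParam ρ i * krawMat (zpar ρ) i k.succ = 0 := by
    simp_rw [krawMat_succ]
    rw [sum_extParam_mul_ite, mul_one, hz]
  have hlt (j k : Fin e) (h : j < k) :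
      ∑ i, extParam ρ i * (krawMat (zpar ρ) i j.succ * krawMat (zpar ρ) i k.succ) = 0 := by
    rw [← h0 k]
    refine sum_congr rfl fun i _ => ?_
    rw [Fin.lt_def] at h
    simp only [krawMat_succ]
    split_ifs <;> first | omega | ring
  refine Fin.cases ?_ (fun j => ?_) j <;> refine Fin.cases ?_ (fun k => ?_) k
  · simp only [krawMat_zero, mul_one, if_true, Fin.cons_zero]
    rw [Fin.sum_univ_castSucc]
    simp_rw [extParam_castSucc, extParam_last]
    ring
  · rw [if_neg (Fin.succ_ne_zero k).symm]
    simp only [krawMat_zero, one_mul, h0]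
  · rw [if_neg (Fin.succ_ne_zero j)]
    simp only [krawMat_zero, mul_one, h0]
  · rcases lt_trichotomy j k with h | h | h
    · rw [if_neg (by simpa using h.ne), hlt j k h]
    · subst h
      rw [if_pos rfl, Fin.cons_succ]
      have : ∀ i, krawMat (zpar ρ) i j.succ * krawMat (zpar ρ) i j.succ =
          if (j : ℕ) < i then 1 else if (j : ℕ) = i then (1 - zpar ρ j) ^ 2 else 0 := fun i => by
        simp only [krawMat_succ]
        split_ifs <;> ring
      simp_rw [this]
      rw [sum_extParam_mul_ite, colNorm, zpar, headSum_add_one]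
      have := (hρ.1 j).1.ne'
      field_simp
      ring
    · rw [if_neg (by simpa using h.ne')]
      simp_rw [mul_comm (krawMat (zpar ρ) _ j.succ)]
      exact hlt k j h

theorem symCoeff_diagonal {e M : ℕ} (c : Fin e → ℝ) {x ν : Fin e → ℕ}
    (hx : ∑ i, x i = M) (hν : ∑ i, ν i = M) :
    symCoeff (Matrix.diagonal c) x ν = if x = ν then ∏ i, c i ^ ν i else 0 := by
  refine symCoeff_eq_of_forall hx (f := fun ν => if x = ν then ∏ i, c i ^ ν i else 0)
    (fun v => ?_) hν
  simp only [ite_mul, zero_mul]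
  rw [sum_ite_eq, if_pos (Nat.mem_antidiagonalTuple.2 hx)]
  simp [Matrix.mulVec_diagonal, mul_pow, prod_mul_distrib]

/-- This is the symmetric power of `Aᵀ D A = diagonal c`, with `D` the diagonal matrix of `extParam
ρ`; the transposition rule supplies the factorials of the multinomial weight. -/
theorem sum_symCoeff_krawMat {e M : ℕ} {ρ : Fin e → ℝ} (hρ : IsParam ρ) {ν μ : Fin (e + 1) → ℕ}
    (hν : ∑ i, ν i = M) (hμ : ∑ i, μ i = M) :
    ∑ x ∈ Nat.antidiagonalTuple (e + 1) M,
      symCoeff (krawMat (zpar ρ)) x ν * symCoeff (krawMat (zpar ρ)) x μ *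
        ∏ i, extParam ρ i ^ x i / ((x i).factorial : ℝ) =
      if ν = μ then ∏ i, (Fin.cons 1 (colNorm ρ) : Fin (e + 1) → ℝ) i ^ μ i /
        ((μ i).factorial : ℝ) else 0 := by
  set A := krawMat (zpar ρ)
  set c : Fin (e + 1) → ℝ := Fin.cons 1 (colNorm ρ)
  have hA : A.transpose * Matrix.of (fun i j => extParam ρ i * 1 * A i j) = Matrix.diagonal c := by
    ext j k
    rw [Matrix.mul_apply, Matrix.diagonal_apply, ← krawMat_orthogonal hρ j k]
    refine sum_congr rfl fun i _ => ?_
    simp only [Matrix.transpose_apply, Matrix.of_apply, A]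
    ring
  have h := symCoeff_diagonal c hν hμ
  rw [← hA, symCoeff_mul _ _ hν hμ] at h
  have hν0 : (∏ i, ((ν i).factorial : ℝ)) ≠ 0 := by positivity
  have h2 : (∏ i, ((ν i).factorial : ℝ)) * ∑ x ∈ Nat.antidiagonalTuple (e + 1) M,
      symCoeff A x ν * symCoeff A x μ * ∏ i, extParam ρ i ^ x i / ((x i).factorial : ℝ) =
      if ν = μ then ∏ i, c i ^ μ i else 0 := by
    rw [← h, mul_sum]
    refine sum_congr rfl fun x hx => ?_
    rw [Nat.mem_antidiagonalTuple] at hx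
    have hx0 : (∏ i, ((x i).factorial : ℝ)) ≠ 0 := by positivity
    rw [symCoeff_scale A _ (fun _ => 1) hx hμ, prod_div_distrib]
    simp only [one_pow, prod_const_one, mul_one]
    have := symCoeff_transpose A hx hν
    field_simp
    linear_combination (symCoeff A x μ * ∏ i, extParam ρ i ^ x i) * this
  rw [← mul_right_inj' hν0, h2]
  split_ifs with heq
  · subst heq
    rw [prod_div_distrib]
    field_simp
  · simp

theorem sum_grid {e N : ℕ} (F : (Fin e → ℕ) → ℝ) :
    ∑ x ∈ grid e N, F x = ∑ x ∈ Nat.antidiagonalTuple (e + 1) N, F (fun i => x i.castSucc) := by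
  symm
  refine Finset.sum_bij (fun x _ => fun i => x i.castSucc) ?_ ?_ ?_ (fun _ _ => rfl)
  · intro x hx
    rw [Nat.mem_antidiagonalTuple, Fin.sum_univ_castSucc] at hx
    rw [mem_grid]
    omega
  · intro x hx y hy h
    rw [Nat.mem_antidiagonalTuple, Fin.sum_univ_castSucc] at hx hy
    have h' : ∀ i : Fin e, x i.castSucc = y i.castSucc := fun i => congrFun h i
    funext i
    refine Fin.lastCases ?_ h' i
    simp_rw [h'] at hx
    omega
  · intro x hx
    rw [mem_grid] at hx
    refine ⟨Fin.snoc x (N - ∑ i, x i), ?_, ?_⟩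
    · rw [Nat.mem_antidiagonalTuple, Fin.sum_univ_castSucc]
      simp only [Fin.snoc_castSucc, Fin.snoc_last]
      omega
    · funext i
      simp

theorem weight_castSucc {e N : ℕ} (ρ : Fin e → ℝ) {x : Fin (e + 1) → ℕ} (hx : ∑ i, x i = N) :
    weight ρ N (fun i => x i.castSucc) =
      N.factorial * ∏ i, extParam ρ i ^ x i / ((x i).factorial : ℝ) := by
  rw [Fin.sum_univ_castSucc] at hx
  rw [weight, Fin.prod_univ_castSucc]
  simp_rw [extParam_castSucc, extParam_last]
  rw [show N - ∑ i : Fin e, x i.castSucc = x (Fin.last e) by omega, mul_assoc]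

/-- The degree `ν` is completed by the exponent `N - n` of the homogenizing variable, whose column
has norm `1`. -/
theorem innerProd_poly {e N n : ℕ} (hn : n ≤ N) {ρ : Fin e → ℝ} (hρ : IsParam ρ)
    {ν μ : Fin e → ℕ} (hν : ∑ i, ν i = n) (hμ : ∑ i, μ i = n) :
    innerProd ρ N (fun x => poly ν x ρ N) (fun x => poly μ x ρ N) =
      if ν = μ then ((N - n).factorial : ℝ) * (∏ i, ((μ i).factorial : ℝ)) / (N.factorial : ℝ) *
        ∏ i, colNorm ρ i ^ μ i else 0 := by
  have hcons {ν : Fin e → ℕ} (hν : ∑ i, ν i = n) :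
      ∑ i, (Fin.cons (N - n) ν : Fin (e + 1) → ℕ) i = N := by
    rw [Fin.sum_univ_succ]; simp only [Fin.cons_zero, Fin.cons_succ]; omega
  have hp {ν : Fin e → ℕ} (hν : ∑ i, ν i = n) {x : Fin (e + 1) → ℕ} (hx : ∑ i, x i = N) :
      poly ν (fun i => (x i.castSucc : ℝ)) ρ N =
        ((N - n).factorial : ℝ) * (∏ i, ((ν i).factorial : ℝ)) / (N.factorial : ℝ) *
          symCoeff (krawMat (zpar ρ)) x (Fin.cons (N - n) ν) := by
    rw [poly_eq_genCoeff hn _ _ hν, symCoeff_krawMat _ hx (hcons hν), Fin.tail_cons]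
  rw [innerProd, sum_grid]
  have h := sum_symCoeff_krawMat hρ (hcons hν) (hcons hμ)
  have hN : (N.factorial : ℝ) ≠ 0 := by positivity
  simp only [Fin.cons_inj, true_and] at h
  calc _ = ((N - n).factorial : ℝ) * (∏ i, ((ν i).factorial : ℝ)) / (N.factorial : ℝ) *
        (((N - n).factorial : ℝ) * (∏ i, ((μ i).factorial : ℝ)) / (N.factorial : ℝ)) *
        N.factorial * ∑ x ∈ Nat.antidiagonalTuple (e + 1) N,
          symCoeff (krawMat (zpar ρ)) x (Fin.cons (N - n) ν) *
            symCoeff (krawMat (zpar ρ)) x (Fin.cons (N - n) μ) *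
            ∏ i, extParam ρ i ^ x i / ((x i).factorial : ℝ) := by
        rw [mul_sum]
        refine sum_congr rfl fun x hx => ?_
        rw [Nat.mem_antidiagonalTuple] at hx
        rw [hp hν hx, hp hμ hx, weight_castSucc ρ hx]
        ring
    _ = _ := by
      rw [h]
      split_ifs with heq
      · subst heq
        rw [Fin.prod_univ_succ]
        simp only [Fin.cons_zero, Fin.cons_succ, one_pow]
        rw [prod_div_distrib]
        have h1 : ((N - n).factorial : ℝ) ≠ 0 := by positivity
        have h2 : (∏ i, ((ν i).factorial : ℝ)) ≠ 0 := by positivity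
        field_simp
      · simp

theorem normSq_eq {e N n : ℕ} (hn : n ≤ N) {ρ : Fin e → ℝ} (hρ : IsParam ρ)
    {ν : Fin e → ℕ} (hν : ∑ i, ν i = n) :
    normSq ν ρ N = ((N - n).factorial : ℝ) * (∏ i, ((ν i).factorial : ℝ)) / (N.factorial : ℝ) *
        ∏ i, colNorm ρ i ^ ν i := by
  rw [normSq, innerProd_poly hn hρ hν hν, if_pos rfl]

theorem headSum_le_sum {e : ℕ} {ρ : Fin e → ℝ} (hρ : IsParam ρ) (j : ℕ) :
    headSum ρ j ≤ ∑ i, ρ i :=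
  sum_le_sum_of_subset_of_nonneg (filter_subset _ _) fun i _ _ => (hρ.1 i).1.le

theorem headSum_lt_one {e : ℕ} {ρ : Fin e → ℝ} (hρ : IsParam ρ) (j : ℕ) : headSum ρ j < 1 :=
  (headSum_le_sum hρ j).trans_lt hρ.2

theorem colNorm_pos {e : ℕ} {ρ : Fin e → ℝ} (hρ : IsParam ρ) (j : Fin e) : 0 < colNorm ρ j :=
  div_pos (mul_pos (sub_pos.2 (headSum_lt_one hρ _)) (sub_pos.2 (headSum_lt_one hρ _)))
    (hρ.1 j).1

theorem normSq_pos {e N n : ℕ} (hn : n ≤ N) {ρ : Fin e → ℝ} (hρ : IsParam ρ)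
    {ν : Fin e → ℕ} (hν : ∑ i, ν i = n) : 0 < normSq ν ρ N := by
  rw [normSq_eq hn hρ hν]
  have : 0 < ∏ i, colNorm ρ i ^ ν i := prod_pos fun i _ => pow_pos (colNorm_pos hρ i) _
  positivity

/-- The Krawtchouk polynomials of a given degree are linearly independent. -/
theorem eq_of_sum_poly {e N n : ℕ} (hn : n ≤ N) {ρ : Fin e → ℝ} (hρ : IsParam ρ)
    {f g : (Fin e → ℕ) → ℝ}
    (h : ∀ x : Fin e → ℝ, ∑ μ ∈ Nat.antidiagonalTuple e n, f μ * poly μ x ρ N =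
      ∑ μ ∈ Nat.antidiagonalTuple e n, g μ * poly μ x ρ N)
    {μ : Fin e → ℕ} (hμ : ∑ i, μ i = n) : f μ = g μ := by
  -- Pairing with `K_μ` isolates the coefficient of index `μ`.
  have key (f : (Fin e → ℕ) → ℝ) : innerProd ρ N
      (fun x => ∑ ν ∈ Nat.antidiagonalTuple e n, f ν * poly ν x ρ N) (fun x => poly μ x ρ N) =
      f μ * normSq μ ρ N := by
    have : innerProd ρ N
        (fun x => ∑ ν ∈ Nat.antidiagonalTuple e n, f ν * poly ν x ρ N)
        (fun x => poly μ x ρ N) = ∑ ν ∈ Nat.antidiagonalTuple e n,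
          f ν * innerProd ρ N (fun x => poly ν x ρ N) (fun x => poly μ x ρ N) := by
      simp only [innerProd, sum_mul, mul_sum]
      rw [sum_comm]
      exact sum_congr rfl fun _ _ => sum_congr rfl fun _ _ => by ring
    rw [this, sum_eq_single_of_mem μ (Nat.mem_antidiagonalTuple.2 hμ)]
    · rfl
    · intro ν hν hne
      rw [innerProd_poly hn hρ (Nat.mem_antidiagonalTuple.1 hν) hμ, if_neg hne, mul_zero]
  have h2 : f μ * normSq μ ρ N = g μ * normSq μ ρ N := by
    rw [← key, ← key]
    simp only [h]
  exact mul_right_cancel₀ (normSq_pos hn hρ hμ).ne' h2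

/-! ### From a matrix relation to connection coefficients. -/

theorem sum_antidiagonalTuple_ite {e M k : ℕ} (hk : k ≤ M) (F : (Fin (e + 1) → ℕ) → ℝ) :
    ∑ ν ∈ Nat.antidiagonalTuple (e + 1) M, (if k = ν 0 then F ν else 0) =
      ∑ ν ∈ Nat.antidiagonalTuple e (M - k), F (Fin.cons k ν) := by
  rw [← sum_filter]
  symm
  refine Finset.sum_bij (fun ν _ => Fin.cons k ν) ?_ ?_ ?_ (fun _ _ => rfl)
  · intro ν hν
    rw [Nat.mem_antidiagonalTuple] at hν
    rw [mem_filter, Nat.mem_antidiagonalTuple, Fin.sum_univ_succ]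
    simp only [Fin.cons_zero, Fin.cons_succ, and_true]
    omega
  · intro ν _ μ _ h
    exact (Fin.cons_inj.1 h).2
  · intro ν hν
    rw [mem_filter, Nat.mem_antidiagonalTuple, Fin.sum_univ_succ] at hν
    refine ⟨Fin.tail ν, ?_, ?_⟩
    · rw [Nat.mem_antidiagonalTuple]
      simp only [Fin.tail]
      omega
    · rw [hν.2, Fin.cons_self_tail]

/-- The block diagonal matrix `1 ⊕ B`. -/
def oneBlock {e : ℕ} (B : Matrix (Fin e) (Fin e) ℝ) : Matrix (Fin (e + 1)) (Fin (e + 1)) ℝ :=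
  Matrix.of (Fin.cons (Fin.cons 1 0) fun j => Fin.cons 0 (B j))

theorem symCoeff_oneBlock {e M : ℕ} (B : Matrix (Fin e) (Fin e) ℝ) {x ν : Fin (e + 1) → ℕ}
    (hx : ∑ i, x i = M) (hν : ∑ i, ν i = M) :
    symCoeff (oneBlock B) x ν = if x 0 = ν 0 then symCoeff B (Fin.tail x) (Fin.tail ν) else 0 := by
  refine symCoeff_eq_of_forall hx
    (f := fun ν => if x 0 = ν 0 then symCoeff B (Fin.tail x) (Fin.tail ν) else 0)
    (fun v => ?_) hν
  rw [Fin.sum_univ_succ] at hx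
  simp only [ite_mul, zero_mul]
  rw [sum_antidiagonalTuple_ite (by omega), Fin.prod_univ_succ]
  have h0 : (oneBlock B).mulVec v 0 = v 0 := by
    simp [oneBlock, Matrix.mulVec, dotProduct, Fin.sum_univ_succ]
  have h1 (i : Fin e) : (oneBlock B).mulVec v i.succ = B.mulVec (Fin.tail v) i := by
    simp [oneBlock, Matrix.mulVec, dotProduct, Fin.sum_univ_succ, Fin.tail]
  simp_rw [h0, h1]
  have := prod_mulVec_pow B (x := Fin.tail x) (M := M - x 0)
    (by simp only [Fin.tail]; omega) (Fin.tail v)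
  simp only [Fin.tail] at this ⊢
  rw [this, mul_sum]
  refine sum_congr rfl fun μ _ => ?_
  rw [Fin.prod_univ_succ]
  simp only [Fin.cons_zero, Fin.cons_succ, Fin.tail_cons]
  ring

/-- If the linear forms of two generating functions are related by `1 ⊕ B` and a permutation, then
`B` gives the connection coefficients. -/
theorem genCoeff_comp_perm {e n M : ℕ} {z z' : Fin e → ℝ} {B : Matrix (Fin e) (Fin e) ℝ}
    {τ : Equiv.Perm (Fin (e + 1))}
    (h : ∀ i l, krawMat z' i l.succ = ∑ j, krawMat z (τ i) j.succ * B j l)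
    {ν : Fin e → ℕ} (hν : ∑ i, ν i = n) (hn : n ≤ M) {x : Fin (e + 1) → ℕ} (hx : ∑ i, x i = M) :
    genCoeff z' ν (fun i => (x (τ i.castSucc) : ℝ)) M =
      ∑ μ ∈ Nat.antidiagonalTuple e n,
        symCoeff B μ ν * genCoeff z μ (fun i => (x i.castSucc : ℝ)) M := by
  have hmat : (krawMat z').submatrix τ.symm (Equiv.refl _) = krawMat z * oneBlock B := by
    ext i l
    rw [Matrix.mul_apply, Fin.sum_univ_succ]
    refine Fin.cases ?_ (fun l => ?_) l
    · simp [krawMat_zero, oneBlock]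
    · rw [Matrix.submatrix_apply, Equiv.refl_apply, h]
      simp [oneBlock]
  have hcons {ν : Fin e → ℕ} (hν : ∑ i, ν i = n) :
      ∑ i, (Fin.cons (M - n) ν : Fin (e + 1) → ℕ) i = M := by
    rw [Fin.sum_univ_succ]; simp only [Fin.cons_zero, Fin.cons_succ]; omega
  have hxτ : ∑ i, (x ∘ τ) i = M := by rw [← hx]; exact Equiv.sum_comp τ x
  have h1 := symCoeff_krawMat z' hxτ (hcons hν)
  have h2 := symCoeff_reindex (krawMat z') τ.symm (Equiv.refl _) hx (hcons hν)
  rw [hmat, symCoeff_mul _ _ hx (hcons hν)] at h2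
  have h3 : (x ∘ τ.symm.symm) = x ∘ τ := rfl
  have h4 : (Fin.cons (M - n) ν ∘ (Equiv.refl (Fin (e + 1))).symm : Fin (e + 1) → ℕ) =
    Fin.cons (M - n) ν := rfl
  rw [h3, h4, h1, Fin.tail_cons] at h2
  refine h2.symm.trans ?_
  -- The block `1` preserves the exponent of the homogenizing variable, so only `μ` with `μ 0 = M -
  -- n` contribute and the degree `n` is kept.
  have h5 : ∀ μ ∈ Nat.antidiagonalTuple (e + 1) M,
      symCoeff (krawMat z) x μ * symCoeff (oneBlock B) μ (Fin.cons (M - n) ν) =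
      if M - n = μ 0 then genCoeff z (Fin.tail μ) (fun i => (x i.castSucc : ℝ)) M *
        symCoeff B (Fin.tail μ) ν else 0 := fun μ hμ => by
    rw [Nat.mem_antidiagonalTuple] at hμ
    rw [symCoeff_krawMat _ hx hμ, symCoeff_oneBlock _ hμ (hcons hν), Fin.cons_zero, Fin.tail_cons,
      mul_ite, mul_zero]
    simp only [eq_comm]
  rw [sum_congr rfl h5, sum_antidiagonalTuple_ite (Nat.sub_le _ _), Nat.sub_sub_self hn]
  exact sum_congr rfl fun μ _ => by rw [Fin.tail_cons, mul_comm]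

/-- Functions on `ℝ^k` given by polynomials. -/
def IsPolyFun {k : ℕ} (f : (Fin k → ℝ) → ℝ) : Prop :=
  ∃ p : MvPolynomial (Fin k) ℝ, ∀ x, MvPolynomial.eval x p = f x

namespace IsPolyFun

variable {k : ℕ} {f g : (Fin k → ℝ) → ℝ}

theorem const (c : ℝ) : IsPolyFun fun _ : Fin k → ℝ => c := ⟨MvPolynomial.C c, by simp⟩

theorem coord (i : Fin k) : IsPolyFun fun x : Fin k → ℝ => x i := ⟨MvPolynomial.X i, by simp⟩

theorem add (hf : IsPolyFun f) (hg : IsPolyFun g) : IsPolyFun fun x => f x + g x := by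
  obtain ⟨p, hp⟩ := hf
  obtain ⟨q, hq⟩ := hg
  exact ⟨p + q, by simp [hp, hq]⟩

theorem mul (hf : IsPolyFun f) (hg : IsPolyFun g) : IsPolyFun fun x => f x * g x := by
  obtain ⟨p, hp⟩ := hf
  obtain ⟨q, hq⟩ := hg
  exact ⟨p * q, by simp [hp, hq]⟩

theorem neg (hf : IsPolyFun f) : IsPolyFun fun x => -f x := by
  simpa using (const (-1)).mul hf

theorem sum {ι : Type*} (s : Finset ι) {f : ι → (Fin k → ℝ) → ℝ} (hf : ∀ i, IsPolyFun (f i)) :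
    IsPolyFun fun x => ∑ i ∈ s, f i x := by
  choose p hp using hf
  exact ⟨∑ i ∈ s, p i, by simp [map_sum, hp]⟩

theorem prod {ι : Type*} (s : Finset ι) {f : ι → (Fin k → ℝ) → ℝ} (hf : ∀ i, IsPolyFun (f i)) :
    IsPolyFun fun x => ∏ i ∈ s, f i x := by
  choose p hp using hf
  exact ⟨∏ i ∈ s, p i, by simp [map_prod, hp]⟩

theorem poch (hf : IsPolyFun f) (l : ℕ) : IsPolyFun fun x => poch (f x) l := by
  induction l with
  | zero => simpa [Krawtchouk.poch] using const 1
  | succ l ih =>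
    simp only [Krawtchouk.poch, ascPochhammer_succ_eval] at ih ⊢
    exact ih.mul (hf.add (const _))

theorem factor (l : ℕ) (hf : IsPolyFun f) (hg : IsPolyFun g) (z : ℝ) :
    IsPolyFun fun x => factor l (f x) (g x) z := by
  unfold Krawtchouk.factor
  refine sum _ fun i => ?_
  simp only [div_eq_mul_inv]
  exact (((((const _).mul (hf.neg.poch i)).mul ((hg.add (const _)).poch _)).mul (const _)).mul
    (const _))

theorem genCoeff {e : ℕ} (z : Fin e → ℝ) (ν : Fin e → ℕ) (σ : Fin e → Fin k) :
    IsPolyFun fun x : Fin k → ℝ => genCoeff z ν (fun i => x (σ i)) (∑ i, x i) := by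
  unfold Krawtchouk.genCoeff headSum
  refine prod _ fun j => (const _).mul (factor _ (coord _) ?_ _)
  exact ((sum _ fun i => coord i).neg.add (sum _ fun i => coord _)).add (const _)

theorem ext_natCast (hf : IsPolyFun f) (hg : IsPolyFun g)
    (h : ∀ x : Fin k → ℕ, f (fun i => (x i : ℝ)) = g (fun i => (x i : ℝ))) : f = g := by
  obtain ⟨p, hp⟩ := hf
  obtain ⟨q, hq⟩ := hg
  have : p = q := by
    refine MvPolynomial.funext_set (fun _ => Set.range (Nat.cast : ℕ → ℝ))
      (fun _ => Set.infinite_range_of_injective Nat.cast_injective) fun x hx => ?_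
    choose y hy using fun i => hx i (Set.mem_univ i)
    obtain rfl : (fun i => (y i : ℝ)) = x := funext hy
    rw [hp, hq, h]
  funext x
  rw [← hp, ← hq, this]

end IsPolyFun

/-- With `T` equal to the sum of all `e + 1` free coordinates, both sides are polynomials, so
agreement at natural points suffices. -/
theorem genCoeff_comp_perm_real {e n : ℕ} {z z' : Fin e → ℝ} {B : Matrix (Fin e) (Fin e) ℝ}
    {τ : Equiv.Perm (Fin (e + 1))}
    (h : ∀ i l, krawMat z' i l.succ = ∑ j, krawMat z (τ i) j.succ * B j l)
    {ν : Fin e → ℕ} (hν : ∑ i, ν i = n) (x : Fin (e + 1) → ℝ) :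
    genCoeff z' ν (fun i => x (τ i.castSucc)) (∑ i, x i) =
      ∑ μ ∈ Nat.antidiagonalTuple e n,
        symCoeff B μ ν * genCoeff z μ (fun i => x i.castSucc) (∑ i, x i) := by
  refine congrFun (IsPolyFun.ext_natCast (IsPolyFun.genCoeff z' ν fun i => τ i.castSucc)
    (IsPolyFun.sum _ fun μ => (IsPolyFun.const _).mul
      (IsPolyFun.genCoeff z μ fun i => i.castSucc)) fun x => ?_) x
  rw [← Nat.cast_sum]
  -- At points of total less than `n` there is no room for the degree, and both sides vanish.
  rcases Nat.lt_or_ge (∑ i, x i) n with hlt | hge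
  · have hx : ∑ i, (x ∘ τ) i = ∑ i, x i := Equiv.sum_comp τ x
    rw [genCoeff_eq_zero z' ν (fun i => x (τ i.castSucc)) _ (hν ▸ hlt)]
    · refine (sum_eq_zero fun μ hμ => ?_).symm
      rw [genCoeff_eq_zero z μ (fun i => x i.castSucc), mul_zero]
      · rw [Fin.sum_univ_castSucc]; omega
      · rwa [Nat.mem_antidiagonalTuple.1 hμ]
    · rw [← hx, Fin.sum_univ_castSucc]
      simp
  · exact genCoeff_comp_perm h hν hge rfl

theorem isConnectionCoeff_symCoeff {d n N : ℕ} (hn : n ≤ N) {τ : Equiv.Perm (Fin (d + 1))}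
    {ρ : Fin d → ℝ} {B : Matrix (Fin d) (Fin d) ℝ}
    (h : ∀ i l, krawMat (zpar (act τ 1 ρ)) i l.succ =
      ∑ j, krawMat (zpar ρ) (τ i) j.succ * B j l) :
    IsConnectionCoeff τ ρ N n fun ν μ =>
      symCoeff B μ ν * (∏ i, ((ν i).factorial : ℝ)) / ∏ i, ((μ i).factorial : ℝ) := by
  intro ν hν x
  -- The appended coordinate makes the total equal to `N` for every real `x`.
  have h1 := genCoeff_comp_perm_real h hν (Fin.snoc x (N - ∑ i, x i) : Fin (d + 1) → ℝ)
  have hs : ∑ i, (Fin.snoc x (N - ∑ i, x i) : Fin (d + 1) → ℝ) i = N := by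
    rw [Fin.sum_univ_castSucc]; simp
  rw [hs] at h1
  simp only [Fin.snoc_castSucc] at h1
  rw [poly_eq_genCoeff hn _ _ hν]
  change _ * genCoeff _ ν (fun i => (Fin.snoc x (N - ∑ i, x i) : Fin (d + 1) → ℝ)
    (τ i.castSucc)) N = _
  rw [h1, mul_sum]
  refine sum_congr rfl fun μ hμ => ?_
  rw [poly_eq_genCoeff hn _ _ (Nat.mem_antidiagonalTuple.1 hμ)]
  have h2 : (∏ i, ((μ i).factorial : ℝ)) ≠ 0 := by positivity
  field_simp

/-! ### The parameters `ρ̂`, `ρ̃` and the rotated `ρ`. -/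

theorem headSum_eq_of_step {e : ℕ} {y : Fin e → ℝ} {F : ℕ → ℝ} (h0 : F 0 = 0)
    (h : ∀ i : Fin e, F ((i : ℕ) + 1) = F i + y i) {k : ℕ} (hk : k ≤ e) : headSum y k = F k := by
  induction k with
  | zero => rw [headSum_zero, h0]
  | succ k ih => rw [headSum_add_one y ⟨k, hk⟩, h ⟨k, hk⟩, ih (by omega)]

section

variable {m : ℕ} {ρ : Fin (m + 1) → ℝ}

theorem headSum_one (ρ : Fin (m + 1) → ℝ) : headSum ρ 1 = ρ 0 := by
  rw [headSum_succ, headSum_zero, add_zero]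

theorem headSum_add_two (ρ : Fin (m + 1) → ℝ) (i : Fin m) :
    headSum ρ ((i : ℕ) + 2) = headSum ρ ((i : ℕ) + 1) + ρ i.succ :=
  headSum_add_one ρ i.succ

theorem one_add_sub_headSum_pos (hρ : IsParam ρ) (k : ℕ) : 0 < 1 + ρ 0 - headSum ρ k := by
  linarith [headSum_lt_one hρ k, (hρ.1 0).1]

theorem isParam_of_pos {e : ℕ} {y : Fin e → ℝ} (h0 : ∀ i, 0 < y i) (h1 : ∑ i, y i < 1) :
    IsParam y :=
  ⟨fun i => ⟨h0 i, (single_le_sum (fun j _ => (h0 j).le) (mem_univ i)).trans_lt h1⟩, h1⟩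

/-- Each `ρ̂_j` is a difference of consecutive values of the right-hand side, so the sum telescopes.
Admissibility then amounts to positivity of this closed form. -/
theorem one_sub_headSum_rhoHat (hρ : IsParam ρ) {k : ℕ} (hk : k ≤ m) :
    1 - headSum (rhoHat ρ) k = (1 - headSum ρ (k + 1)) /
      ((1 - ρ 0) * (1 + ρ 0 - headSum ρ (k + 1))) := by
  have h1 : 1 - ρ 0 ≠ 0 := (sub_pos.2 (hρ.1 0).2).ne'
  rw [headSum_eq_of_step (F := fun k => 1 - (1 - headSum ρ (k + 1)) /
      ((1 - ρ 0) * (1 + ρ 0 - headSum ρ (k + 1)))) ?_ (fun i => ?_) hk, sub_sub_cancel]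
  · simp only [zero_add, headSum_one]
    field_simp
    ring
  · have h2 := (one_add_sub_headSum_pos hρ ((i : ℕ) + 1)).ne'
    have h3 := (one_add_sub_headSum_pos hρ ((i : ℕ) + 2)).ne'
    simp only [rhoHat, add_assoc, Nat.reduceAdd]
    rw [headSum_add_two] at *
    field_simp
    ring

theorem one_sub_headSum_rhoTilde (hρ : IsParam ρ) {k : ℕ} (hk : k ≤ m) :
    1 - headSum (rhoTilde ρ) k = (1 - ∑ j, ρ j) * (1 + ρ 0 - headSum ρ (m + 1 - k)) /
      ((1 + ρ 0 - ∑ j, ρ j) * (1 - headSum ρ (m + 1 - k))) := by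
  have h1 : 1 + ρ 0 - ∑ j, ρ j ≠ 0 := by
    rw [← headSum_self]; exact (one_add_sub_headSum_pos hρ _).ne'
  have h0 : 1 - ∑ j, ρ j ≠ 0 := (sub_pos.2 hρ.2).ne'
  rw [headSum_eq_of_step (F := fun k => 1 - (1 - ∑ j, ρ j) *
      (1 + ρ 0 - headSum ρ (m + 1 - k)) /
      ((1 + ρ 0 - ∑ j, ρ j) * (1 - headSum ρ (m + 1 - k)))) ?_ (fun i => ?_) hk, sub_sub_cancel]
  · simp only [Nat.sub_zero, headSum_self]
    field_simp
    ring
  · have h2 := (sub_pos.2 (headSum_lt_one hρ ((i.rev : ℕ) + 1))).ne'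
    have h3 := (sub_pos.2 (headSum_lt_one hρ ((i.rev : ℕ) + 2))).ne'
    have e1 : m + 1 - ((i : ℕ) + 1) = (i.rev : ℕ) + 1 := by rw [Fin.val_rev]; omega
    have e2 : m + 1 - (i : ℕ) = (i.rev : ℕ) + 2 := by rw [Fin.val_rev]; omega
    simp only [rhoTilde]
    rw [e1, e2, headSum_add_two] at *
    field_simp
    ring

theorem isParam_rhoHat (hρ : IsParam ρ) : IsParam (rhoHat ρ) := by
  refine isParam_of_pos (fun i => ?_) ?_
  · exact div_pos (mul_pos (hρ.1 _).1 (hρ.1 _).1) (mul_pos (mul_pos (sub_pos.2 (hρ.1 0).2)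
      (one_add_sub_headSum_pos hρ _)) (one_add_sub_headSum_pos hρ _))
  · rw [← sub_pos, ← headSum_self, one_sub_headSum_rhoHat hρ le_rfl]
    exact div_pos (sub_pos.2 (headSum_lt_one hρ _)) (mul_pos (sub_pos.2 (hρ.1 0).2)
      (one_add_sub_headSum_pos hρ _))

theorem isParam_rhoTilde (hρ : IsParam ρ) : IsParam (rhoTilde ρ) := by
  have h1 : 0 < 1 + ρ 0 - ∑ j, ρ j := by
    rw [← headSum_self]; exact one_add_sub_headSum_pos hρ _
  refine isParam_of_pos (fun i => ?_) ?_
  · exact div_pos (mul_pos (mul_pos (hρ.1 _).1 (hρ.1 _).1) (sub_pos.2 hρ.2))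
      (mul_pos (mul_pos (sub_pos.2 (headSum_lt_one hρ _)) (sub_pos.2 (headSum_lt_one hρ _))) h1)
  · rw [← sub_pos, ← headSum_self, one_sub_headSum_rhoTilde hρ le_rfl]
    exact div_pos (mul_pos (sub_pos.2 hρ.2) (one_add_sub_headSum_pos hρ _))
      (mul_pos h1 (sub_pos.2 (headSum_lt_one hρ _)))

theorem zpar_rhoHat (hρ : IsParam ρ) (i : Fin m) :
    zpar (rhoHat ρ) i = (1 - headSum ρ ((i : ℕ) + 1)) * (1 + ρ 0 - headSum ρ ((i : ℕ) + 2)) /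
      (ρ 0 * ρ i.succ) := by
  have h1 : 1 - ρ 0 ≠ 0 := (sub_pos.2 (hρ.1 0).2).ne'
  have h2 := (one_add_sub_headSum_pos hρ ((i : ℕ) + 1)).ne'
  have h3 := (one_add_sub_headSum_pos hρ ((i : ℕ) + 2)).ne'
  have h4 := (hρ.1 0).1.ne'
  have h5 := (hρ.1 i.succ).1.ne'
  rw [zpar, one_sub_headSum_rhoHat hρ i.2.le, rhoHat]
  field_simp

theorem one_sub_zpar_rhoHat (hρ : IsParam ρ) (i : Fin m) :
    1 - zpar (rhoHat ρ) i = -((1 - headSum ρ ((i : ℕ) + 2)) * (1 + ρ 0 - headSum ρ ((i : ℕ) + 1)) /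
      (ρ 0 * ρ i.succ)) := by
  have h4 := (hρ.1 0).1.ne'
  have h5 := (hρ.1 i.succ).1.ne'
  rw [zpar_rhoHat hρ, headSum_add_two]
  field_simp
  ring

/-- The coincidence behind the two formulas: `ρ̂` and `ρ̃` have the same hypergeometric arguments in
opposite order, so one matrix `B` serves both. -/
theorem zpar_rhoTilde (hρ : IsParam ρ) (i : Fin m) :
    zpar (rhoTilde ρ) i = zpar (rhoHat ρ) i.rev := by
  have h1 : 1 + ρ 0 - ∑ j, ρ j ≠ 0 := by
    rw [← headSum_self]; exact (one_add_sub_headSum_pos hρ _).ne'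
  have h0 : 1 - ∑ j, ρ j ≠ 0 := (sub_pos.2 hρ.2).ne'
  have h2 := (sub_pos.2 (headSum_lt_one hρ ((i.rev : ℕ) + 1))).ne'
  have h3 := (sub_pos.2 (headSum_lt_one hρ ((i.rev : ℕ) + 2))).ne'
  have h4 := (hρ.1 0).1.ne'
  have h5 := (hρ.1 i.rev.succ).1.ne'
  have e2 : m + 1 - (i : ℕ) = (i.rev : ℕ) + 2 := by rw [Fin.val_rev]; omega
  rw [zpar_rhoHat hρ, zpar, one_sub_headSum_rhoTilde hρ i.2.le, rhoTilde, e2]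
  field_simp

theorem colNorm_succ (ρ : Fin (m + 1) → ℝ) (i : Fin m) : colNorm ρ i.succ =
    (1 - headSum ρ ((i : ℕ) + 1)) * (1 - headSum ρ ((i : ℕ) + 2)) / ρ i.succ := rfl

theorem colNorm_zero (ρ : Fin (m + 1) → ℝ) : colNorm ρ 0 = (1 - ρ 0) / ρ 0 := by
  simp [colNorm, headSum_zero, headSum_one]

theorem colNorm_rhoHat (hρ : IsParam ρ) (i : Fin m) :
    colNorm (rhoHat ρ) i = colNorm ρ i.succ / ((1 - ρ 0) * ρ 0) := by
  have h1 : 1 - ρ 0 ≠ 0 := (sub_pos.2 (hρ.1 0).2).ne'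
  have h2 := (one_add_sub_headSum_pos hρ ((i : ℕ) + 1)).ne'
  have h3 := (one_add_sub_headSum_pos hρ ((i : ℕ) + 2)).ne'
  have h4 := (hρ.1 0).1.ne'
  have h5 := (hρ.1 i.succ).1.ne'
  rw [colNorm, one_sub_headSum_rhoHat hρ i.2.le, one_sub_headSum_rhoHat hρ i.2, rhoHat,
    colNorm_succ]
  field_simp

/-- The parameters `(ρ_2, …, ρ_d, ρ_1)`. -/
def rotate (ρ : Fin (m + 1) → ℝ) : Fin (m + 1) → ℝ := Fin.snoc (Fin.tail ρ) (ρ 0)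

theorem rotate_castSucc (ρ : Fin (m + 1) → ℝ) (i : Fin m) : rotate ρ i.castSucc = ρ i.succ := by
  simp [rotate, Fin.tail]

theorem rotate_last (ρ : Fin (m + 1) → ℝ) : rotate ρ (Fin.last m) = ρ 0 := by
  simp [rotate]

theorem sum_rotate (ρ : Fin (m + 1) → ℝ) : ∑ i, rotate ρ i = ∑ i, ρ i := by
  rw [Fin.sum_univ_castSucc, Fin.sum_univ_succ, add_comm]
  simp_rw [rotate_castSucc, rotate_last]

theorem isParam_rotate (hρ : IsParam ρ) : IsParam (rotate ρ) := by
  refine isParam_of_pos (fun i => ?_) (by rw [sum_rotate]; exact hρ.2)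
  refine Fin.lastCases ?_ (fun i => ?_) i
  · rw [rotate_last]; exact (hρ.1 _).1
  · rw [rotate_castSucc]; exact (hρ.1 _).1

theorem headSum_rotate (ρ : Fin (m + 1) → ℝ) {k : ℕ} (hk : k ≤ m) :
    headSum (rotate ρ) k = headSum ρ (k + 1) - ρ 0 := by
  induction k with
  | zero => rw [headSum_zero, zero_add, headSum_one, sub_self]
  | succ k ih =>
    have h := headSum_add_one (rotate ρ) (Fin.castSucc ⟨k, hk⟩)
    rw [rotate_castSucc] at h
    have h2 := headSum_add_two ρ ⟨k, hk⟩
    simp only [Fin.val_castSucc] at h h2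
    rw [h, h2, ih (by omega)]
    ring

theorem zpar_rotate_castSucc (ρ : Fin (m + 1) → ℝ) (i : Fin m) :
    zpar (rotate ρ) i.castSucc = (1 + ρ 0 - headSum ρ ((i : ℕ) + 1)) / ρ i.succ := by
  rw [zpar, Fin.val_castSucc, headSum_rotate ρ i.2.le, rotate_castSucc]
  congr 1
  ring

theorem colNorm_rotate_castSucc (ρ : Fin (m + 1) → ℝ) (i : Fin m) :
    colNorm (rotate ρ) i.castSucc =
      (1 + ρ 0 - headSum ρ ((i : ℕ) + 1)) * (1 + ρ 0 - headSum ρ ((i : ℕ) + 2)) / ρ i.succ := by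
  rw [colNorm, Fin.val_castSucc, headSum_rotate ρ i.2.le, headSum_rotate ρ i.2, rotate_castSucc]
  congr 1
  ring

theorem colNorm_rotate_last (ρ : Fin (m + 1) → ℝ) :
    colNorm (rotate ρ) (Fin.last m) = (1 + ρ 0 - ∑ i, ρ i) * (1 - ∑ i, ρ i) / ρ 0 := by
  rw [colNorm, Fin.val_last, headSum_rotate ρ le_rfl, rotate_last, headSum_self, headSum_self,
    sum_rotate]
  congr 1
  ring

theorem colNorm_rhoTilde (hρ : IsParam ρ) (i : Fin m) :
    colNorm (rhoTilde ρ) i = colNorm (rotate ρ) i.rev.castSucc * (1 - ∑ j, ρ j) /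
      ((1 + ρ 0 - ∑ j, ρ j) * ρ 0) := by
  have h1 : 1 + ρ 0 - ∑ j, ρ j ≠ 0 := by
    rw [← headSum_self]; exact (one_add_sub_headSum_pos hρ _).ne'
  have h0 : 1 - ∑ j, ρ j ≠ 0 := (sub_pos.2 hρ.2).ne'
  have h2 := (sub_pos.2 (headSum_lt_one hρ ((i.rev : ℕ) + 1))).ne'
  have h3 := (sub_pos.2 (headSum_lt_one hρ ((i.rev : ℕ) + 2))).ne'
  have h4 := (hρ.1 0).1.ne'
  have h5 := (hρ.1 i.rev.succ).1.ne'
  have e1 : m + 1 - ((i : ℕ) + 1) = (i.rev : ℕ) + 1 := by rw [Fin.val_rev]; omega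
  have e2 : m + 1 - (i : ℕ) = (i.rev : ℕ) + 2 := by rw [Fin.val_rev]; omega
  rw [colNorm, one_sub_headSum_rhoTilde hρ i.2.le, one_sub_headSum_rhoTilde hρ i.2, rhoTilde,
    colNorm_rotate_castSucc, e1, e2]
  field_simp

/-! ### The transition matrix of the cycle. -/

/-- The factors of the columns of `krawMat (zpar (rhoHat ρ))` in `transMat ρ`. -/
def hatCol (ρ : Fin (m + 1) → ℝ) : Fin (m + 1) → ℝ := Fin.cons 1 fun _ => ρ 0

/-- The factors of the rows of `krawMat (zpar (rhoHat ρ))` in `transMat ρ`. -/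
def hatRow (ρ : Fin (m + 1) → ℝ) : Fin (m + 1) → ℝ :=
  Fin.snoc (fun _ => -1) ((1 - ∑ i, ρ i) / ρ 0)

/-- The linear substitution that connects the generating functions for `rotate ρ` and `ρ`. -/
def transMat (ρ : Fin (m + 1) → ℝ) : Matrix (Fin (m + 1)) (Fin (m + 1)) ℝ :=
  Matrix.of fun j l => hatCol ρ j / colNorm ρ j * hatRow ρ l *
    (krawMat (zpar (rhoHat ρ))).transpose j l

/-- The factors of the rows of `krawMat (zpar (rhoTilde ρ))` in `transMat ρ`. -/
def tildeRow (ρ : Fin (m + 1) → ℝ) : Fin (m + 1) → ℝ :=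
  Fin.cons ((1 - ∑ i, ρ i) / ρ 0) fun _ => 1 - ∑ i, ρ i

/-- The factors of the columns of `krawMat (zpar (rhoTilde ρ))` in `transMat ρ`. -/
def tildeCol (ρ : Fin (m + 1) → ℝ) : Fin (m + 1) → ℝ :=
  Fin.snoc (fun _ => -(ρ 0 / (1 - ∑ i, ρ i))) 1

theorem transMat_eq (hρ : IsParam ρ) : transMat ρ =
    Matrix.of fun j l => tildeRow ρ j / colNorm ρ j * tildeCol ρ l *
      (krawMat (zpar (rhoTilde ρ))).submatrix Fin.revPerm Fin.revPerm j l := by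
  have h4 := (hρ.1 0).1.ne'
  have h0 : 1 - ∑ j, ρ j ≠ 0 := (sub_pos.2 hρ.2).ne'
  ext j l
  simp only [transMat, Matrix.of_apply, Matrix.transpose_apply, Matrix.submatrix_apply,
    Fin.revPerm_apply]
  have hj := (colNorm_pos hρ j).ne'
  suffices h : hatCol ρ j * hatRow ρ l * krawMat (zpar (rhoHat ρ)) l j =
      tildeRow ρ j * tildeCol ρ l * krawMat (zpar (rhoTilde ρ)) j.rev l.rev by
    field_simp
    linear_combination h
  refine Fin.cases ?_ (fun j => ?_) j <;> refine Fin.lastCases ?_ (fun l => ?_) l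
  · simp only [hatCol, hatRow, tildeRow, tildeCol, Fin.cons_zero, Fin.snoc_last, krawMat_zero,
      Fin.rev_last]
    ring
  · simp only [hatCol, hatRow, tildeRow, tildeCol, Fin.cons_zero, Fin.snoc_castSucc, krawMat_zero,
      Fin.rev_castSucc, krawMat_succ, Fin.rev_zero, Fin.val_last, Fin.is_lt, if_true]
    field_simp
  · simp only [hatCol, hatRow, tildeRow, tildeCol, Fin.cons_succ, Fin.snoc_last, krawMat_zero,
      Fin.rev_last, krawMat_succ, Fin.val_last, Fin.is_lt, if_true]
    field_simp
  · simp only [hatCol, hatRow, tildeRow, tildeCol, Fin.cons_succ, Fin.snoc_castSucc, Fin.rev_succ,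
      Fin.rev_castSucc, krawMat_succ, Fin.val_castSucc, Fin.val_rev]
    rw [zpar_rhoTilde hρ, Fin.rev_rev]
    rcases lt_trichotomy (j : ℕ) l with h | h | h
    · rw [if_pos h, if_pos (by omega)]
      field_simp
    · rw [if_neg (by omega), if_pos h, if_neg (by omega), if_pos (by omega), Fin.ext h]
      field_simp
    · rw [if_neg (by omega), if_neg (by omega), if_neg (by omega), if_neg (by omega)]
      ring

theorem sum_krawMat_castSucc {e : ℕ} (z y : Fin e → ℝ) (i : Fin e) :
    ∑ j, krawMat z i.castSucc j.succ * y j = headSum y i + (1 - z i) * y i := by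
  have h : (1 - z i) * y i = ∑ j, if j = i then (1 - z j) * y j else 0 := by simp
  rw [h, headSum, sum_filter, ← sum_add_distrib]
  refine sum_congr rfl fun j _ => ?_
  simp only [krawMat_succ, Fin.val_castSucc, Fin.ext_iff]
  split_ifs <;> first | omega | ring

theorem sum_krawMat_last {e : ℕ} (z y : Fin e → ℝ) :
    ∑ j, krawMat z (Fin.last e) j.succ * y j = headSum y e := by
  rw [headSum_self]
  refine sum_congr rfl fun j _ => ?_
  rw [krawMat_succ, Fin.val_last, if_pos j.2, one_mul]

theorem transMat_zero (hρ : IsParam ρ) (l : Fin (m + 1)) :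
    transMat ρ 0 l = hatRow ρ l * ρ 0 / (1 - ρ 0) := by
  have h1 : 1 - ρ 0 ≠ 0 := (sub_pos.2 (hρ.1 0).2).ne'
  have h4 := (hρ.1 0).1.ne'
  simp only [transMat, Matrix.of_apply, Matrix.transpose_apply, krawMat_zero, hatCol,
    Fin.cons_zero, colNorm_zero]
  field_simp

/-- The form as a difference lets the column sums telescope. -/
theorem transMat_succ_of_lt (hρ : IsParam ρ) {k : Fin m} {l : Fin (m + 1)} (h : (k : ℕ) < l) :
    transMat ρ k.succ l = hatRow ρ l * ρ 0 / (1 - headSum ρ ((k : ℕ) + 2)) -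
      hatRow ρ l * ρ 0 / (1 - headSum ρ ((k : ℕ) + 1)) := by
  have h2 := (sub_pos.2 (headSum_lt_one hρ ((k : ℕ) + 1))).ne'
  have h3 := (sub_pos.2 (headSum_lt_one hρ ((k : ℕ) + 2))).ne'
  have h5 := (hρ.1 k.succ).1.ne'
  simp only [transMat, Matrix.of_apply, Matrix.transpose_apply, krawMat_succ, hatCol,
    Fin.cons_succ, colNorm_succ, if_pos h]
  rw [headSum_add_two] at *
  field_simp
  ring

theorem transMat_succ_self (hρ : IsParam ρ) (k : Fin m) :
    transMat ρ k.succ k.castSucc = 1 + ρ 0 / (1 - headSum ρ ((k : ℕ) + 1)) := by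
  have h2 := (sub_pos.2 (headSum_lt_one hρ ((k : ℕ) + 1))).ne'
  have h3 := (sub_pos.2 (headSum_lt_one hρ ((k : ℕ) + 2))).ne'
  have h4 := (hρ.1 0).1.ne'
  have h5 := (hρ.1 k.succ).1.ne'
  simp only [transMat, Matrix.of_apply, Matrix.transpose_apply, krawMat_succ, hatCol, hatRow,
    Fin.cons_succ, colNorm_succ, Fin.val_castSucc, lt_self_iff_false, if_false, if_true,
    one_sub_zpar_rhoHat hρ, Fin.snoc_castSucc]
  field_simp
  ring

theorem transMat_succ_of_gt {k : Fin m} {l : Fin (m + 1)} (h : (l : ℕ) < k) :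
    transMat ρ k.succ l = 0 := by
  simp only [transMat, Matrix.of_apply, Matrix.transpose_apply, krawMat_succ]
  rw [if_neg (by omega), if_neg (by omega), mul_zero]

/-- Rows of `krawMat` are essentially prefix sums, so these sums are all that a product with
`transMat ρ` needs. They telescope down to row `l`; the entry in row `l + 1`, if there is one,
brings the sum to `1`, and the entries below are zero. -/
theorem headSum_transMat (hρ : IsParam ρ) (l : Fin (m + 1)) {k : ℕ} (hk : k ≤ m) :
    headSum (fun j => transMat ρ j l) (k + 1) =
      if k ≤ l then hatRow ρ l * ρ 0 / (1 - headSum ρ (k + 1)) else 1 := by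
  induction k with
  | zero =>
    rw [headSum_one, transMat_zero hρ, if_pos (Nat.zero_le _), zero_add, headSum_one]
  | succ k ih =>
    rw [headSum_add_two _ ⟨k, hk⟩, ih (by omega)]
    rcases lt_trichotomy k l with h | h | h
    · rw [if_pos h.le, if_pos (by omega), transMat_succ_of_lt hρ h, add_sub_cancel]
    · obtain rfl : l = Fin.castSucc ⟨k, hk⟩ := Fin.ext h.symm
      rw [transMat_succ_self hρ]
      simp only [hatRow, Fin.snoc_castSucc, Fin.val_castSucc]
      rw [if_pos le_rfl, if_neg (by omega)]
      ring
    · rw [if_neg (by omega), if_neg (by omega), transMat_succ_of_gt (k := ⟨k, hk⟩) h, add_zero]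

theorem cyclicPerm_last (m : ℕ) : cyclicPerm m (Fin.last (m + 1)) = Fin.last (m + 1) := by
  rw [cyclicPerm, Fin.cycleRange_of_gt (Fin.castSucc_lt_last _)]

theorem cyclicPerm_castSucc_last (m : ℕ) :
    cyclicPerm m (Fin.last m).castSucc = (0 : Fin (m + 1)).castSucc := by
  simp [cyclicPerm]

theorem cyclicPerm_castSucc_castSucc {m : ℕ} (j : Fin m) :
    cyclicPerm m j.castSucc.castSucc = j.succ.castSucc := by
  rw [cyclicPerm, Fin.cycleRange_of_lt (by simp [Fin.lt_def])]
  ext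
  simp

theorem krawMat_rotate (hρ : IsParam ρ) (i : Fin (m + 2)) (l : Fin (m + 1)) :
    krawMat (zpar (rotate ρ)) i l.succ =
      ∑ j, krawMat (zpar ρ) (cyclicPerm m i) j.succ * transMat ρ j l := by
  have h0 := (hρ.1 0).1.ne'
  have h1 : 1 - ρ 0 ≠ 0 := (sub_pos.2 (hρ.1 0).2).ne'
  have hS : 1 - ∑ j, ρ j ≠ 0 := (sub_pos.2 hρ.2).ne'
  refine Fin.lastCases ?_ (fun i => Fin.lastCases ?_ (fun i => ?_) i) i
  -- The last row of ones requires every full column sum to be `1`; in the last column this fixes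
  -- the last entry of `hatRow`.
  · rw [cyclicPerm_last, sum_krawMat_last, headSum_transMat hρ l le_rfl, krawMat_succ,
      Fin.val_last, if_pos l.2]
    refine Fin.lastCases ?_ (fun l => ?_) l
    · simp only [hatRow, Fin.snoc_last, Fin.val_last, le_refl, if_true, headSum_self]
      field_simp
    · rw [Fin.val_castSucc, if_neg (by omega)]
  · rw [cyclicPerm_castSucc_last, sum_krawMat_castSucc, transMat_zero hρ, krawMat_succ]
    simp only [zpar, Fin.val_zero, headSum_zero, Fin.val_castSucc, Fin.val_last]
    refine Fin.lastCases ?_ (fun l => ?_) l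
    · rw [Fin.val_last, if_neg (by omega), if_pos rfl, headSum_rotate ρ le_rfl, headSum_self,
        rotate_last]
      simp only [hatRow, Fin.snoc_last]
      field_simp
      ring
    · rw [Fin.val_castSucc, if_pos l.2]
      simp only [hatRow, Fin.snoc_castSucc]
      field_simp
      ring
  · have h2 := (sub_pos.2 (headSum_lt_one hρ ((i : ℕ) + 1))).ne'
    have h3 := (sub_pos.2 (headSum_lt_one hρ ((i : ℕ) + 2))).ne'
    have h5 := (hρ.1 i.succ).1.ne'
    rw [cyclicPerm_castSucc_castSucc, sum_krawMat_castSucc, Fin.val_succ,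
      headSum_transMat hρ l i.2.le, krawMat_succ]
    simp only [Fin.val_castSucc]
    rcases lt_trichotomy (l : ℕ) i with h | h | h
    · rw [if_pos h, if_neg (by omega), transMat_succ_of_gt h, mul_zero, add_zero]
    · obtain rfl : l = i.castSucc := Fin.ext h
      rw [transMat_succ_self hρ, zpar_rotate_castSucc]
      simp only [hatRow, Fin.snoc_castSucc, Fin.val_castSucc, lt_self_iff_false, if_false, if_true,
        le_refl, zpar, Fin.val_succ]
      field_simp
      ring
    · rw [if_neg (by omega), if_neg (by omega), if_pos h.le, transMat_succ_of_lt hρ h, zpar,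
        Fin.val_succ]
      rw [headSum_add_two] at *
      field_simp
      ring

theorem act_cyclicPerm_eq_rotate (ρ : Fin (m + 1) → ℝ) :
    act (cyclicPerm m) 1 ρ = rotate ρ := act_cyclicPerm m 1 ρ

/-! ### Normalization and signs. -/

theorem prod_factorial_tail {e n : ℕ} {ν : Fin (e + 1) → ℕ} (hν : ∑ i, ν i = n) :
    ((n - ∑ i, Fin.tail ν i).factorial : ℝ) * ∏ i, ((Fin.tail ν i).factorial : ℝ) =
      ∏ i, ((ν i).factorial : ℝ) := by
  rw [Fin.sum_univ_succ] at hν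
  rw [Fin.prod_univ_succ, show n - ∑ i, Fin.tail ν i = ν 0 by simp only [Fin.tail]; omega]
  rfl

theorem sum_tail_le {e n : ℕ} {ν : Fin (e + 1) → ℕ} (hν : ∑ i, ν i = n) :
    ∑ i, Fin.tail ν i ≤ n := by
  rw [Fin.sum_univ_succ] at hν
  simp only [Fin.tail]
  omega

/-- Here `n` takes the place of `N`: the first entry of `ν` is the homogenizing exponent and the
last entry of `x` is the complementary coordinate. -/
theorem symCoeff_krawMat_zpar {e n : ℕ} (ρ : Fin e → ℝ) {x ν : Fin (e + 1) → ℕ}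
    (hx : ∑ i, x i = n) (hν : ∑ i, ν i = n) :
    symCoeff (krawMat (zpar ρ)) x ν = (n.factorial : ℝ) / (∏ i, ((ν i).factorial : ℝ)) *
      poly (Fin.tail ν) (fun i => (x i.castSucc : ℝ)) ρ n := by
  rw [symCoeff_krawMat _ hx hν, poly_eq_genCoeff (sum_tail_le hν) _ _ rfl, prod_factorial_tail hν]
  have h1 : (∏ i, ((ν i).factorial : ℝ)) ≠ 0 := by positivity
  field_simp

theorem normSq_tail {e n : ℕ} {ρ : Fin e → ℝ} (hρ : IsParam ρ) {ν : Fin (e + 1) → ℕ}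
    (hν : ∑ i, ν i = n) : normSq (Fin.tail ν) ρ n =
      (∏ i, ((ν i).factorial : ℝ)) / (n.factorial : ℝ) *
        ∏ i, (Fin.cons 1 (colNorm ρ) : Fin (e + 1) → ℝ) i ^ ν i := by
  rw [normSq_eq (sum_tail_le hν) hρ rfl, prod_factorial_tail hν,
    Fin.prod_univ_succ fun i => (Fin.cons 1 (colNorm ρ) : Fin (e + 1) → ℝ) i ^ ν i]
  simp only [Fin.cons_zero, one_pow, one_mul, Fin.cons_succ]
  rfl

/-- An identity between square roots is reduced to one of signs and one of squares. -/
theorem sqrt_div_mul {A B y s W C : ℝ} (hW : 0 ≤ W) (hy : y = s * |y|)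
    (h : A / B * y ^ 2 = W / C) : Real.sqrt (A / B) * y = s * Real.sqrt W * (Real.sqrt C)⁻¹ := by
  have h1 : Real.sqrt (A / B) * |y| = Real.sqrt W * (Real.sqrt C)⁻¹ := by
    rw [← div_eq_mul_inv, ← Real.sqrt_div hW, ← h, mul_comm, mul_comm (A / B),
      Real.sqrt_mul (sq_nonneg y), Real.sqrt_sq_eq_abs]
  rw [mul_assoc, ← h1, mul_left_comm, ← hy]

theorem prod_pow_eq_sign_mul {b : Fin (m + 1) → ℝ} (hb : ∀ i : Fin m, b i.castSucc < 0)
    (hb' : 0 < b (Fin.last m)) {n : ℕ} {ν : Fin (m + 1) → ℕ} (hν : ∑ i, ν i = n) :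
    ∏ i, b i ^ ν i = (-1) ^ (n + ν (Fin.last m)) * |∏ i, b i ^ ν i| := by
  rw [Fin.sum_univ_castSucc] at hν
  have h1 : ∏ i : Fin m, b i.castSucc ^ ν i.castSucc =
      (-1) ^ (n + ν (Fin.last m)) * ∏ i : Fin m, |b i.castSucc| ^ ν i.castSucc := by
    have h2 : (-1 : ℝ) ^ (n + ν (Fin.last m)) = ∏ i : Fin m, (-1) ^ ν i.castSucc := by
      -- The negative factors occur `n - ν_d` times, which has the parity of `n + ν_d`.
      rw [prod_pow_eq_pow_sum, ← hν, add_assoc, pow_add, ← two_mul, pow_mul (-1 : ℝ) 2]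
      simp
    rw [h2, ← prod_mul_distrib]
    exact prod_congr rfl fun i _ => by rw [← mul_pow, abs_of_neg (hb i), neg_one_mul, neg_neg]
  rw [abs_prod, Fin.prod_univ_castSucc, h1, Fin.prod_univ_castSucc]
  simp_rw [abs_pow]
  rw [abs_of_pos hb', mul_assoc]

/-- Serves both formulas, with `a` and `b` the scale factors of `transMat ρ`. The factor `(N - n)! /
N!` cancels in the quotient of norms, so `N` drops out. -/
theorem sqrt_normSq_div_mul {n N : ℕ} (hn : n ≤ N) (hρ : IsParam ρ)
    {a b : Fin (m + 1) → ℝ} (ha : ∀ i, 0 < a i) (hb : ∀ i : Fin m, b i.castSucc < 0)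
    (hb' : 0 < b (Fin.last m)) {ν μ : Fin (m + 1) → ℕ} (hν : ∑ i, ν i = n) (hμ : ∑ i, μ i = n)
    {W C : ℝ} (hW : 0 ≤ W)
    (h : (∏ i, (colNorm ρ i * a i ^ 2) ^ μ i) * (∏ i, (b i ^ 2 / colNorm (rotate ρ) i) ^ ν i) *
      ((n.factorial : ℝ) ^ 2 / ((∏ i, ((μ i).factorial : ℝ)) * ∏ i, ((ν i).factorial : ℝ))) =
      W / C) :
    Real.sqrt (normSq μ ρ N / normSq ν (rotate ρ) N) * ((∏ i, a i ^ μ i) * (∏ i, b i ^ ν i) *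
      ((n.factorial : ℝ) / ∏ i, ((μ i).factorial : ℝ))) =
      (-1) ^ (n + ν (Fin.last m)) * Real.sqrt W * (Real.sqrt C)⁻¹ := by
  have ha' : 0 < ∏ i, a i ^ μ i := prod_pos fun i _ => pow_pos (ha i) _
  have hf : 0 < (n.factorial : ℝ) / ∏ i, ((μ i).factorial : ℝ) := by positivity
  refine sqrt_div_mul hW ?_ ?_
  · rw [abs_mul, abs_mul, abs_of_pos ha', abs_of_pos hf]
    have := prod_pow_eq_sign_mul hb hb' hν
    linear_combination (∏ i, a i ^ μ i) * ((n.factorial : ℝ) / ∏ i, ((μ i).factorial : ℝ)) * this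
  · rw [← h, normSq_eq hn hρ hμ, normSq_eq hn (isParam_rotate hρ) hν]
    simp_rw [mul_pow, div_pow, prod_mul_distrib, prod_div_distrib]
    have h1 (c : Fin (m + 1) → ℝ) (ν : Fin (m + 1) → ℕ) :
        ∏ i, (c i ^ 2) ^ ν i = (∏ i, c i ^ ν i) ^ 2 := by
      rw [← prod_pow]
      exact prod_congr rfl fun i _ => by rw [← pow_mul, ← pow_mul, mul_comm]
    rw [h1, h1]
    have h2 : 0 < ∏ i, colNorm (rotate ρ) i ^ ν i :=
      prod_pos fun i _ => pow_pos (colNorm_pos (isParam_rotate hρ) i) _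
    have h3 : (∏ i, ((μ i).factorial : ℝ)) ≠ 0 := by positivity
    have h4 : (∏ i, ((ν i).factorial : ℝ)) ≠ 0 := by positivity
    field_simp

/-- The balance of constants: a common factor `g` cancels in degree `n`. -/
theorem prod_pow_mul_prod_pow {e n : ℕ} {g : ℝ} (hg : g ≠ 0) {p q p' q' : Fin e → ℝ}
    (hp : ∀ i, p i = g * p' i) (hq : ∀ i, q i = (g * q' i)⁻¹) {ν μ : Fin e → ℕ}
    (hν : ∑ i, ν i = n) (hμ : ∑ i, μ i = n) :
    (∏ i, p i ^ ν i) * ∏ i, q i ^ μ i = (∏ i, p' i ^ ν i) / ∏ i, q' i ^ μ i := by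
  simp_rw [hp, hq, inv_pow, mul_pow]
  rw [prod_inv_distrib, prod_mul_distrib, prod_mul_distrib, prod_pow_eq_pow_sum,
    prod_pow_eq_pow_sum, hν, hμ]
  field_simp

/-- Since `transMat ρ 0 l = hatRow ρ l / colNorm ρ 0`, this identifies the squares of the normalized
first row with the extended `ρ̂`. The factor `colNorm ρ 0` cancels against `colNorm_mul_hatCol_sq`
in degree `n`. -/
theorem hatRow_sq_div (hρ : IsParam ρ) (l : Fin (m + 1)) :
    hatRow ρ l ^ 2 / colNorm (rotate ρ) l = colNorm ρ 0 * extParam (rhoHat ρ) l := by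
  have h0 := (hρ.1 0).1.ne'
  have h1 : 1 - ρ 0 ≠ 0 := (sub_pos.2 (hρ.1 0).2).ne'
  have hS : 1 - ∑ j, ρ j ≠ 0 := (sub_pos.2 hρ.2).ne'
  have hS' : 1 + ρ 0 - ∑ j, ρ j ≠ 0 := by
    rw [← headSum_self]; exact (one_add_sub_headSum_pos hρ _).ne'
  refine Fin.lastCases ?_ (fun l => ?_) l
  · rw [colNorm_rotate_last, colNorm_zero, extParam_last,
      ← headSum_self (rhoHat ρ), one_sub_headSum_rhoHat hρ le_rfl, headSum_self]
    simp only [hatRow, Fin.snoc_last]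
    field_simp
  · have h2 := (one_add_sub_headSum_pos hρ ((l : ℕ) + 1)).ne'
    have h3 := (one_add_sub_headSum_pos hρ ((l : ℕ) + 2)).ne'
    have h5 := (hρ.1 l.succ).1.ne'
    rw [colNorm_rotate_castSucc, colNorm_zero, extParam_castSucc, rhoHat]
    simp only [hatRow, Fin.snoc_castSucc]
    field_simp

theorem colNorm_mul_hatCol_sq (hρ : IsParam ρ) (j : Fin (m + 1)) :
    colNorm ρ j * (hatCol ρ j / colNorm ρ j) ^ 2 =
      (colNorm ρ 0 * (Fin.cons 1 (colNorm (rhoHat ρ)) : Fin (m + 1) → ℝ) j)⁻¹ := by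
  have h0 := (hρ.1 0).1.ne'
  have h1 : 1 - ρ 0 ≠ 0 := (sub_pos.2 (hρ.1 0).2).ne'
  refine Fin.cases ?_ (fun j => ?_) j
  · rw [colNorm_zero]
    simp only [hatCol, Fin.cons_zero]
    field_simp
  · have hj := (colNorm_pos hρ j.succ).ne'
    simp only [hatCol, Fin.cons_succ]
    rw [colNorm_rhoHat hρ, colNorm_zero]
    field_simp

/-- The same for the last column of `transMat ρ`, whose entries are `tildeRow ρ j / colNorm ρ j`;
its normalized squares are the extended `ρ̃`, reversed. -/
theorem colNorm_mul_tildeRow_sq (hρ : IsParam ρ) (j : Fin (m + 1)) :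
    colNorm ρ j * (tildeRow ρ j / colNorm ρ j) ^ 2 =
      colNorm (rotate ρ) (Fin.last m) * extParam (rhoTilde ρ) j.rev := by
  have h0 := (hρ.1 0).1.ne'
  have h1 : 1 - ρ 0 ≠ 0 := (sub_pos.2 (hρ.1 0).2).ne'
  have hS : 1 - ∑ j, ρ j ≠ 0 := (sub_pos.2 hρ.2).ne'
  have hS' : 1 + ρ 0 - ∑ j, ρ j ≠ 0 := by
    rw [← headSum_self]; exact (one_add_sub_headSum_pos hρ _).ne'
  refine Fin.cases ?_ (fun j => ?_) j
  · rw [colNorm_rotate_last, colNorm_zero, Fin.rev_zero, extParam_last, ← headSum_self (rhoTilde ρ),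
      one_sub_headSum_rhoTilde hρ le_rfl, Nat.add_sub_cancel_left, headSum_one]
    simp only [tildeRow, Fin.cons_zero]
    field_simp
    ring
  · have h2 := (sub_pos.2 (headSum_lt_one hρ ((j : ℕ) + 1))).ne'
    have h3 := (sub_pos.2 (headSum_lt_one hρ ((j : ℕ) + 2))).ne'
    have h5 := (hρ.1 j.succ).1.ne'
    rw [colNorm_rotate_last, colNorm_succ, Fin.rev_succ, extParam_castSucc, rhoTilde, Fin.rev_rev]
    simp only [tildeRow, Fin.cons_succ]
    field_simp

theorem tildeCol_sq_div (hρ : IsParam ρ) (l : Fin (m + 1)) :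
    tildeCol ρ l ^ 2 / colNorm (rotate ρ) l = (colNorm (rotate ρ) (Fin.last m) *
      (Fin.cons 1 (colNorm (rhoTilde ρ)) : Fin (m + 1) → ℝ) l.rev)⁻¹ := by
  have h0 := (hρ.1 0).1.ne'
  have hS : 1 - ∑ j, ρ j ≠ 0 := (sub_pos.2 hρ.2).ne'
  have hS' : 1 + ρ 0 - ∑ j, ρ j ≠ 0 := by
    rw [← headSum_self]; exact (one_add_sub_headSum_pos hρ _).ne'
  refine Fin.lastCases ?_ (fun l => ?_) l
  · rw [Fin.rev_last, Fin.cons_zero]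
    simp [tildeCol]
  · have hl := (colNorm_pos (isParam_rotate hρ) l.castSucc).ne'
    rw [Fin.rev_castSucc, Fin.cons_succ, colNorm_rhoTilde hρ, Fin.rev_rev, colNorm_rotate_last]
    simp only [tildeCol, Fin.snoc_castSucc]
    field_simp

theorem weight_nonneg {e N : ℕ} {ρ : Fin e → ℝ} (hρ : IsParam ρ) (x : Fin e → ℕ) :
    0 ≤ weight ρ N x := by
  have h1 : 0 ≤ ∏ i, ρ i ^ x i / ((x i).factorial : ℝ) :=
    prod_nonneg fun i _ => div_nonneg (pow_nonneg (hρ.1 i).1.le _) (Nat.cast_nonneg _)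
  have h2 : 0 ≤ 1 - ∑ i, ρ i := (sub_pos.2 hρ.2).le
  rw [weight]
  positivity

/-- Undoing the transpose makes `ν` the point and `μ` the degree; the factorials this costs are
those of the connection coefficient. -/
theorem symCoeff_transMat_hat {n : ℕ} {ν μ : Fin (m + 1) → ℕ} (hν : ∑ i, ν i = n)
    (hμ : ∑ i, μ i = n) :
    symCoeff (transMat ρ) μ ν * (∏ i, ((ν i).factorial : ℝ)) / ∏ i, ((μ i).factorial : ℝ) =
      (∏ i, (hatCol ρ i / colNorm ρ i) ^ μ i) * (∏ i, hatRow ρ i ^ ν i) *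
        ((n.factorial : ℝ) / ∏ i, ((μ i).factorial : ℝ)) *
        poly (fun i => μ i.succ) (fun i => (ν i.castSucc : ℝ)) (rhoHat ρ) n := by
  have h1 := symCoeff_transpose (krawMat (zpar (rhoHat ρ))) hν hμ
  rw [symCoeff_krawMat_zpar _ hν hμ] at h1
  have h2 : (∏ i, ((μ i).factorial : ℝ)) ≠ 0 := by positivity
  rw [transMat, symCoeff_scale _ _ _ hμ hν, mul_assoc _ _ (∏ i, ((ν i).factorial : ℝ)),
    mul_comm _ (∏ i, ((ν i).factorial : ℝ)), ← h1]
  field_simp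
  rfl

/-- No transpose here: `μ` stays the point and `ν` the degree, both reversed by `Fin.revPerm`. -/
theorem symCoeff_transMat_tilde (hρ : IsParam ρ) {n : ℕ} {ν μ : Fin (m + 1) → ℕ}
    (hν : ∑ i, ν i = n) (hμ : ∑ i, μ i = n) :
    symCoeff (transMat ρ) μ ν * (∏ i, ((ν i).factorial : ℝ)) / ∏ i, ((μ i).factorial : ℝ) =
      (∏ i, (tildeRow ρ i / colNorm ρ i) ^ μ i) * (∏ i, tildeCol ρ i ^ ν i) *
        ((n.factorial : ℝ) / ∏ i, ((μ i).factorial : ℝ)) *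
        poly (fun i => ν i.rev.castSucc) (fun i => (μ i.rev.succ : ℝ)) (rhoTilde ρ) n := by
  have hrev {ν : Fin (m + 1) → ℕ} (hν : ∑ i, ν i = n) : ∑ i, (ν ∘ Fin.revPerm.symm) i = n := by
    rw [← hν]; exact Equiv.sum_comp Fin.revPerm.symm ν
  have hf : ∏ i, (((ν ∘ Fin.revPerm.symm) i).factorial : ℝ) = ∏ i, ((ν i).factorial : ℝ) :=
    Equiv.prod_comp Fin.revPerm.symm fun i => ((ν i).factorial : ℝ)
  have h2 : (∏ i, ((ν i).factorial : ℝ)) ≠ 0 := by positivity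
  rw [transMat_eq hρ, symCoeff_scale _ _ _ hμ hν, symCoeff_reindex _ _ _ hμ hν,
    symCoeff_krawMat_zpar _ (hrev hμ) (hrev hν), hf]
  have e1 : (fun i : Fin m => ν i.rev.castSucc) = Fin.tail (ν ∘ Fin.revPerm.symm) := by
    funext i; simp [Fin.tail, Fin.rev_succ]
  have e2 : (fun i : Fin m => (μ i.rev.succ : ℝ)) =
      fun i => ((μ ∘ Fin.revPerm.symm) i.castSucc : ℝ) := by
    funext i; simp [Fin.rev_castSucc]
  rw [e1, e2]
  field_simp

theorem cons_one_pos {e : ℕ} {c : Fin e → ℝ} (hc : ∀ i, 0 < c i) (i : Fin (e + 1)) :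
    0 < (Fin.cons 1 c : Fin (e + 1) → ℝ) i :=
  Fin.cases (by simp) (fun i => by simpa using hc i) i

theorem sqrt_mul_symCoeff_hat (hρ : IsParam ρ) {n N : ℕ} (hn : n ≤ N) {ν μ : Fin (m + 1) → ℕ}
    (hν : ∑ i, ν i = n) (hμ : ∑ i, μ i = n) :
    Real.sqrt (normSq μ ρ N / normSq ν (rotate ρ) N) *
      (symCoeff (transMat ρ) μ ν * (∏ i, ((ν i).factorial : ℝ)) / ∏ i, ((μ i).factorial : ℝ)) =
      (-1) ^ (n + ν (Fin.last m)) * Real.sqrt (weight (rhoHat ρ) n (fun i => ν i.castSucc)) *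
        polyHat (fun i => μ i.succ) (fun i => (ν i.castSucc : ℝ)) (rhoHat ρ) n := by
  have h := sqrt_normSq_div_mul hn hρ (a := fun i => hatCol ρ i / colNorm ρ i) (b := hatRow ρ)
    (fun i => div_pos (Fin.cases one_pos (fun _ => (hρ.1 0).1) i) (colNorm_pos hρ i))
    (fun i => by simp [hatRow])
    (by simpa [hatRow] using div_pos (sub_pos.2 hρ.2) (hρ.1 0).1) hν hμ
    (weight_nonneg (N := n) (isParam_rhoHat hρ) (fun i => ν i.castSucc))
    (C := normSq (fun i => μ i.succ) (rhoHat ρ) n) (by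
      have h1 := prod_pow_mul_prod_pow (colNorm_pos hρ 0).ne' (hatRow_sq_div hρ)
        (colNorm_mul_hatCol_sq hρ) hν hμ
      have h2 : 0 < ∏ i, (Fin.cons 1 (colNorm (rhoHat ρ)) : Fin (m + 1) → ℝ) i ^ μ i :=
        prod_pos fun i _ => pow_pos (cons_one_pos (colNorm_pos (isParam_rhoHat hρ)) _) _
      have h3 : (∏ i, ((μ i).factorial : ℝ)) ≠ 0 := by positivity
      have hC : normSq (fun i => μ i.succ) (rhoHat ρ) n = _ := normSq_tail (isParam_rhoHat hρ) hμ
      rw [mul_comm (∏ i, _ ^ μ i), h1, weight_castSucc _ hν, hC, prod_div_distrib]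
      field_simp)
  rw [symCoeff_transMat_hat hν hμ, ← mul_assoc, h, polyHat, mul_assoc]

theorem sqrt_mul_symCoeff_tilde (hρ : IsParam ρ) {n N : ℕ} (hn : n ≤ N) {ν μ : Fin (m + 1) → ℕ}
    (hν : ∑ i, ν i = n) (hμ : ∑ i, μ i = n) :
    Real.sqrt (normSq μ ρ N / normSq ν (rotate ρ) N) *
      (symCoeff (transMat ρ) μ ν * (∏ i, ((ν i).factorial : ℝ)) / ∏ i, ((μ i).factorial : ℝ)) =
      (-1) ^ (n + ν (Fin.last m)) * Real.sqrt (weight (rhoTilde ρ) n (fun i => μ i.rev.succ)) *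
        polyHat (fun i => ν i.rev.castSucc) (fun i => (μ i.rev.succ : ℝ)) (rhoTilde ρ) n := by
  have hS := sub_pos.2 hρ.2
  have hrev {ν : Fin (m + 1) → ℕ} (hν : ∑ i, ν i = n) :
      ∑ i : Fin (m + 1), ν i.rev = n := by
    rw [← hν]; exact Equiv.sum_comp Fin.revPerm ν
  have hprod (F : Fin (m + 1) → ℝ) : ∏ i : Fin (m + 1), F i.rev = ∏ i, F i :=
    Equiv.prod_comp Fin.revPerm F
  have h := sqrt_normSq_div_mul hn hρ (a := fun i => tildeRow ρ i / colNorm ρ i) (b := tildeCol ρ)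
    (fun i => div_pos (Fin.cases (div_pos hS (hρ.1 0).1) (fun _ => hS) i) (colNorm_pos hρ i))
    (fun i => by simpa [tildeCol] using div_pos (hρ.1 0).1 hS)
    (by simp [tildeCol]) hν hμ
    (weight_nonneg (N := n) (isParam_rhoTilde hρ) (fun i => μ i.rev.succ))
    (C := normSq (fun i => ν i.rev.castSucc) (rhoTilde ρ) n) (by
      have h1 := prod_pow_mul_prod_pow (colNorm_pos (isParam_rotate hρ) (Fin.last m)).ne'
        (colNorm_mul_tildeRow_sq hρ) (tildeCol_sq_div hρ) hμ hν
      have h2 : 0 < ∏ i, (Fin.cons 1 (colNorm (rhoTilde ρ)) : Fin (m + 1) → ℝ) i.rev ^ ν i :=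
        prod_pos fun i _ => pow_pos (cons_one_pos (colNorm_pos (isParam_rhoTilde hρ)) _) _
      have h3 : (∏ i, ((ν i).factorial : ℝ)) ≠ 0 := by positivity
      have hW := weight_castSucc (rhoTilde ρ) (hrev hμ)
      have hC := normSq_tail (isParam_rhoTilde hρ) (hrev hν)
      rw [prod_div_distrib, hprod fun i => ((μ i).factorial : ℝ),
        ← hprod fun i => extParam (rhoTilde ρ) i ^ μ i.rev] at hW
      rw [hprod fun i => ((ν i).factorial : ℝ),
        ← hprod fun i => (Fin.cons 1 (colNorm (rhoTilde ρ)) : Fin (m + 1) → ℝ) i ^ ν i.rev] at hC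
      simp only [Fin.rev_castSucc, Fin.rev_rev] at hW hC
      have htail : (Fin.tail fun i : Fin (m + 1) => ν i.rev) = fun i => ν i.rev.castSucc := by
        funext i
        simp [Fin.tail, Fin.rev_succ]
      rw [htail] at hC
      rw [h1, hW, hC]
      field_simp)
  rw [symCoeff_transMat_tilde hρ hν hμ, ← mul_assoc, h, polyHat, mul_assoc]

theorem isConnectionCoeff_cyclicPerm (hρ : IsParam ρ) {n N : ℕ} (hn : n ≤ N) :
    IsConnectionCoeff (cyclicPerm m) ρ N n fun ν μ => symCoeff (transMat ρ) μ ν *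
      (∏ i, ((ν i).factorial : ℝ)) / ∏ i, ((μ i).factorial : ℝ) :=
  isConnectionCoeff_symCoeff hn fun i l => by
    rw [act_cyclicPerm_eq_rotate]
    exact krawMat_rotate hρ i l

end

end Krawtchouk

end

theorem mainTheorem7 (m : ℕ) (ρ : Fin (m + 1) → ℝ) (hρ : Krawtchouk.IsParam ρ)
    (n N : ℕ) (hnN : n ≤ N) :
    Krawtchouk.IsParam (Krawtchouk.rhoHat ρ) ∧
    Krawtchouk.IsParam (Krawtchouk.rhoTilde ρ) ∧
    (∃ k, Krawtchouk.IsConnectionCoeff (Krawtchouk.cyclicPerm m) ρ N n k) ∧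
    ∀ k, Krawtchouk.IsConnectionCoeff (Krawtchouk.cyclicPerm m) ρ N n k →
      ∀ ν μ : Fin (m + 1) → ℕ, ∑ i, ν i = n → ∑ i, μ i = n →
        Krawtchouk.normalized (Krawtchouk.cyclicPerm m) ρ N k ν μ =
          (-1) ^ (n + ν (Fin.last m)) *
            Real.sqrt (Krawtchouk.weight (Krawtchouk.rhoHat ρ) n (fun i => ν i.castSucc)) *
            Krawtchouk.polyHat (fun i => μ i.succ) (fun i => (ν i.castSucc : ℝ))
              (Krawtchouk.rhoHat ρ) n ∧
        Krawtchouk.normalized (Krawtchouk.cyclicPerm m) ρ N k ν μ =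
          (-1) ^ (n + ν (Fin.last m)) *
            Real.sqrt (Krawtchouk.weight (Krawtchouk.rhoTilde ρ) n (fun i => μ i.rev.succ)) *
            Krawtchouk.polyHat (fun i => ν i.rev.castSucc) (fun i => (μ i.rev.succ : ℝ))
              (Krawtchouk.rhoTilde ρ) n := by
  refine ⟨Krawtchouk.isParam_rhoHat hρ, Krawtchouk.isParam_rhoTilde hρ,
    ⟨_, Krawtchouk.isConnectionCoeff_cyclicPerm hρ hnN⟩, fun k hk ν μ hν hμ => ?_⟩
  -- Linear independence forces every family of connection coefficients to agree in degree `n` with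
  -- the one built from `transMat ρ`.
  have h : k ν μ = _ := Krawtchouk.eq_of_sum_poly hnN hρ
    (f := k ν) (fun x => (hk ν hν x).symm.trans
      (Krawtchouk.isConnectionCoeff_cyclicPerm hρ hnN ν hν x)) hμ
  rw [Krawtchouk.normalized, Krawtchouk.act_cyclicPerm_eq_rotate, h]
  exact ⟨Krawtchouk.sqrt_mul_symCoeff_hat hρ hnN hν hμ,
    Krawtchouk.sqrt_mul_symCoeff_tilde hρ hnN hν hμ⟩
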